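/- Let $q$ be a power of an odd prime, $G=\mathrm{PSL}(2,q^2)$, $M$ a maximal subgroup of $G$ isomorphic to $\mathrm{PGL}(2,q)$, and $g\in M$ a semisimple element of order greater than $2$. Let $\mathcal D$ be the incidence structure whose point set is the conjugacy class $g^G$ and whose block set is $\mathcal B=\{(M\cap g^G)^y : y\in G\}$, where $u^y=y^{-1}uy$. For a point $x\in g^G$ let $I_x$ be the intersection of all blocks containing $x$. Let $\mathcal D_I$ be the incidence structure whose points are the distinct sets $I_x$ ($x\in g^G$) and whose blocks are the sets $\bar B=\{I_x : x\in g^G,\ I_x\subseteq B\}$ for $B\in\mathcal B$. A $1$-$(v,k,\lambda)$ design has $v$ points, each block has $k$ points, and each point lies in exactly $\lambda$ blocks. Then the order of $g$ divides $q-1$ or $q+1$. Write $\mathcal D=\mathcal D^+$ if it divides $q-1$, and $\mathcal D=\mathcal D^-$ if it divides $q+1$. (a) $\mathcal D^{\pm}$ is a $1$-$\left(q^2(q^2+1),\ q(q\pm1),\ \tfrac{q\pm1}{2}\right)$ design, respectively. (b) In the case of $\mathcal D^-$ assume in addition that $q>3$ (equivalently, that $\lambda=\tfrac{q-1}{2}\ge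 2$). Then $I_x=\{x,x^{-1}\}$ for all $x\in g^G$, and the reduced design $\mathcal D^{\pm}_I$ is a $1$-$\left(\tfrac{q^2(q^2+1)}{2},\ \tfrac{q(q\pm1)}{2},\ \tfrac{q\pm1}{2}\right)$ design, respectively. -/

import Mathlib

/-- `(P, B)` is a `1-(v, k, lam)` design with point set `P` and block set `B`: there are exactly `v`
points, every block is a set of `k` points, and every point lies in exactly `lam` blocks. -/
structure IsOneDesign {α : Type*} (P : Set α) (B : Set (Set α)) (v k lam : ℕ) : Prop where
  finite_points : P.Finite
  card_points : P.ncard = v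
  block_subset : ∀ b ∈ B, b ⊆ P
  card_block : ∀ b ∈ B, b.ncard = k
  card_blocks_through : ∀ x ∈ P, {b ∈ B | x ∈ b}.ncard = lam

/-- The block set `{(M ∩ g^G)^y : y ∈ G}` on the point set `g^G = conjugatesOf g`,
where `u^y = y⁻¹ * u * y`. -/
def conjBlocks {G : Type*} [Group G] (M : Subgroup G) (g : G) : Set (Set G) :=
  Set.range fun y : G => (fun u : G => y⁻¹ * u * y) '' ((M : Set G) ∩ conjugatesOf g)

/-- `I_x`: the intersection of all blocks containing the point `x`. -/
def pointIntersection {α : Type*} (B : Set (Set α)) (x : α) : Set α :=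
  ⋂₀ {b ∈ B | x ∈ b}

/-- The points of the reduced design: the distinct sets `I_x`. -/
def reducedPoints {α : Type*} (P : Set α) (B : Set (Set α)) : Set (Set α) :=
  pointIntersection B '' P

/-- The blocks of the reduced design: for each block `b`, the set of all `I_x` contained in `b`. -/
def reducedBlocks {α : Type*} (P : Set α) (B : Set (Set α)) : Set (Set (Set α)) :=
  (fun b => {I ∈ reducedPoints P B | I ⊆ b}) '' B

/-- An element of `PSL(2, K)` is semisimple if a matrix in `SL(2, K)` representing it is a
semisimple linear map (for finite `K`: diagonalizable over an algebraic closure). As the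
representatives differ by scalars, the choice of the representative does not matter. -/
def IsSemisimplePSL {K : Type*} [Field K]
    (g : Matrix.ProjectiveSpecialLinearGroup (Fin 2) K) : Prop :=
  ∃ A : Matrix.SpecialLinearGroup (Fin 2) K,
    (QuotientGroup.mk A : Matrix.ProjectiveSpecialLinearGroup (Fin 2) K) = g ∧
      Module.End.IsSemisimple (Matrix.toLin' (A : Matrix (Fin 2) (Fin 2) K))

/-! Everything is read off from eigenvalues. Lift `g`, viewed in `PGL(2,q)`, to a matrix with
eigenvalues `α ≠ β`; the order of `g` is that of `α / β`. The Frobenius `x ↦ x ^ q` fixes or swaps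
`α` and `β`, so this order divides `q - 1` or `q + 1`. Counting matrices with the same trace and
determinant gives class size `q(q ± 1)` in `PGL(2,q)`. In `PSL(2,q²)` the eigenvalues of `g` always
lie in the field, and its class has size `q²(q² + 1)`.

The bridge is that distinct tori meet trivially (`eq_or_eq_inv_of_commute`): if a nontrivial `t`
commutes with `g` and with a conjugate `y` of `g`, then `y = g` or `y = g⁻¹`. An element of `M ∩
g^G` is `M`-conjugate to some power `g ^ k`, because in `PGL(2,q)` elements of this order generate
conjugate subgroups (`exists_isConj_pow`). Then `g ^ k` is a `G`-conjugate of `g` commuting with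
`g`, hence `g` or `g⁻¹`, which are conjugate in `M`. So `M ∩ g^G` is one `M`-class, of size `q(q ±
1)`. Maximality of `M` makes the number of blocks equal to the index `q(q² + 1)/2`, and double
counting gives `λ` (`isOneDesign_conjBlocks`).

For the reduction, `I_g` contains `g` and `g⁻¹`, and the centralizer of `g`, of order `(q² - 1)/2`,
acts freely on the rest of `I_g`. The sets `I_x` all have the size of `I_g` and partition each
block, so `2 + m(q² - 1)/2` divides `q(q ± 1)`. For `q > 3` this forces `m = 0`
(`eq_zero_of_two_add_mul_dvd`), and the reduced design is the quotient by inversion. -/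

section

open Matrix

/-! ### Linear algebra of 2 × 2 matrices -/

section TwoByTwo

variable {E : Type*} [Field E]

/-- A nonscalar `2 × 2` matrix over a field is similar to its companion matrix. -/
theorem exists_conj_companion {X : Matrix (Fin 2) (Fin 2) E} (hX : ∀ c : E, X ≠ c • 1) :
    ∃ P : GL (Fin 2) E, X * (P : Matrix (Fin 2) (Fin 2) E) =
      (P : Matrix (Fin 2) (Fin 2) E) * !![0, -X.det; 1, X.trace] := by
  -- The hypothesis says that `v = (a, b)` is a cyclic vector; in the basis `v, Xv` the matrix
  -- becomes its companion.
  have key : ∀ a b : E,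
      a * (X 1 0 * a + X 1 1 * b) - b * (X 0 0 * a + X 0 1 * b) ≠ 0 →
      ∃ P : GL (Fin 2) E, X * (P : Matrix (Fin 2) (Fin 2) E) =
        (P : Matrix (Fin 2) (Fin 2) E) * !![0, -X.det; 1, X.trace] := by
    intro a b h
    refine ⟨Matrix.GeneralLinearGroup.mkOfDetNeZero
      !![a, X 0 0 * a + X 0 1 * b; b, X 1 0 * a + X 1 1 * b] ?_, ?_⟩
    · rw [Matrix.det_fin_two_of]
      intro h0
      apply h
      linear_combination h0
    · ext i j
      fin_cases i <;> fin_cases j <;>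
        simp [Matrix.GeneralLinearGroup.mkOfDetNeZero, Matrix.mul_apply, Fin.sum_univ_two,
          Matrix.det_fin_two, Matrix.trace_fin_two] <;> ring
  -- If `e₁`, `e₂` and `e₁ + e₂` are all eigenvectors, then `X` is scalar; so one of them is cyclic.
  by_cases h10 : X 1 0 = 0
  · by_cases h01 : X 0 1 = 0
    · refine key 1 1 fun h => hX (X 0 0) ?_
      have h' : X 1 1 = X 0 0 := by linear_combination h - h10 + h01
      ext i j
      fin_cases i <;> fin_cases j <;> simp [h10, h01, h']
    · exact key 0 1 (by simpa using h01)
  · exact key 1 0 (by simpa using h10)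

/-- Nonscalar `2 × 2` matrices with equal trace and determinant are similar. -/
theorem exists_conj_of_trace_eq_of_det_eq {X Y : Matrix (Fin 2) (Fin 2) E}
    (hX : ∀ c : E, X ≠ c • 1) (hY : ∀ c : E, Y ≠ c • 1)
    (ht : X.trace = Y.trace) (hd : X.det = Y.det) :
    ∃ P : GL (Fin 2) E, (P : Matrix (Fin 2) (Fin 2) E) * X = Y * P := by
  obtain ⟨P, hP⟩ := exists_conj_companion hX
  obtain ⟨R, hR⟩ := exists_conj_companion hY
  rw [← ht, ← hd] at hR
  refine ⟨R * P⁻¹, ?_⟩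
  have h1 : (P⁻¹ : GL (Fin 2) E).1 * X = !![0, -X.det; 1, X.trace] * (P⁻¹ : GL (Fin 2) E).1 := by
    calc (P⁻¹ : GL (Fin 2) E).1 * X
        = (P⁻¹ : GL (Fin 2) E).1 * (X * P.1) * (P⁻¹ : GL (Fin 2) E).1 := by
          rw [mul_assoc, mul_assoc, Units.mul_inv, mul_one]
      _ = _ := by rw [hP, ← mul_assoc, Units.inv_mul, one_mul]
  rw [Units.val_mul, mul_assoc, h1, ← mul_assoc, ← mul_assoc, hR]

/-- Cayley-Hamilton in dimension two. -/
theorem sq_eq_trace_smul_sub_det (X : Matrix (Fin 2) (Fin 2) E) :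
    X * X = X.trace • X - X.det • 1 := by
  ext i j
  fin_cases i <;> fin_cases j <;>
    simp [Matrix.mul_apply, Fin.sum_univ_two, Matrix.det_fin_two, Matrix.trace_fin_two] <;> ring

/-- Reducing the `n`-th power modulo the characteristic polynomial yields one pair `u, w`, valid
both for the matrix and for each eigenvalue in an extension. This transfers statements about powers
of `X` to powers of eigenvalues. -/
theorem exists_pow_eq_linear (L : Type*) [Field L] [Algebra E L]
    (X : Matrix (Fin 2) (Fin 2) E) (n : ℕ) :
    ∃ u w : E, X ^ n = u • 1 + w • X ∧ ∀ α : L,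
      α * α = algebraMap E L X.trace * α - algebraMap E L X.det →
      α ^ n = algebraMap E L u + algebraMap E L w * α := by
  induction n with
  | zero => exact ⟨1, 0, by simp, by simp⟩
  | succ n ih =>
    obtain ⟨u, w, h, hα⟩ := ih
    refine ⟨-w * X.det, u + w * X.trace, ?_, fun α h2 => ?_⟩
    · rw [pow_succ, h, add_mul, smul_mul_assoc, smul_mul_assoc, one_mul,
        sq_eq_trace_smul_sub_det]
      module
    · rw [pow_succ, hα α h2]
      simp only [map_add, map_mul, map_neg]
      linear_combination (algebraMap E L w) * h2

/-- A matrix commuting with a nonscalar `2 × 2` matrix is a polynomial in it. -/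
theorem exists_eq_linear_of_commute {X Y : Matrix (Fin 2) (Fin 2) E}
    (hX : ∀ c : E, X ≠ c • 1) (h : Y * X = X * Y) : ∃ u w : E, Y = u • 1 + w • X := by
  have e := fun i j => congrFun (congrFun h i) j
  have e00 := e 0 0
  have e01 := e 0 1
  have e10 := e 1 0
  simp only [Matrix.mul_apply, Fin.sum_univ_two] at e00 e01 e10
  have key : ∀ w : E, Y 0 1 = w * X 0 1 → Y 1 0 = w * X 1 0 →
      Y 0 0 - Y 1 1 = w * (X 0 0 - X 1 1) → ∃ u w : E, Y = u • 1 + w • X := by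
    intro w h1 h2 h3
    refine ⟨Y 0 0 - w * X 0 0, w, ?_⟩
    ext i j
    fin_cases i <;> fin_cases j
    · simp
    · simpa using h1
    · simpa using h2
    · simp
      linear_combination -h3
  by_cases h10 : X 1 0 = 0
  · by_cases h01 : X 0 1 = 0
    · have hd : X 0 0 - X 1 1 ≠ 0 := fun h0 => hX (X 0 0) (by
        ext i j
        fin_cases i <;> fin_cases j <;> simp [h10, h01, ← sub_eq_zero.1 h0])
      refine key ((Y 0 0 - Y 1 1) / (X 0 0 - X 1 1)) ?_ ?_ ?_
      · rw [h01] at e01 ⊢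
        rw [mul_zero]
        refine (mul_eq_zero.1 ?_).resolve_right hd
        linear_combination -e01
      · rw [h10] at e10 ⊢
        rw [mul_zero]
        refine (mul_eq_zero.1 ?_).resolve_right hd
        linear_combination e10
      · field_simp
    · refine key (Y 0 1 / X 0 1) ?_ ?_ ?_
      · field_simp
      · field_simp
        linear_combination -e00
      · field_simp
        linear_combination e01
  · refine key (Y 1 0 / X 1 0) ?_ ?_ ?_
    · field_simp
      linear_combination e00
    · field_simp
    · field_simp
      linear_combination -e10

end TwoByTwo

/-! ### Counting matrices with given trace and determinant -/

section Count

variable {E : Type*} [Field E] [Fintype E]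

theorem card_mul_eq [DecidableEq E] (c : E) : Nat.card {p : E × E // p.1 * p.2 = c} =
    (Fintype.card E - 1) + if c = 0 then Fintype.card E else 0 := by
  have e : {p : E × E // p.1 * p.2 = c} ≃ Σ y : E, {z : E // y * z = c} :=
    { toFun := fun p => ⟨p.1.1, p.1.2, p.2⟩
      invFun := fun s => ⟨(s.1, s.2.1), s.2.2⟩
      left_inv := fun _ => rfl
      right_inv := fun _ => rfl }
  have h : ∀ y : E, Nat.card {z : E // y * z = c} =
      if y = 0 then (if c = 0 then Fintype.card E else 0) else 1 := by
    intro y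
    by_cases hy : y = 0
    · subst hy
      by_cases hc : c = 0
      · simp [hc]
      · simp [hc, Ne.symm hc]
    · rw [if_neg hy]
      have : ∀ z, y * z = c ↔ z = y⁻¹ * c := fun z => by
        rw [eq_inv_mul_iff_mul_eq₀ hy]
      simp [this]
  rw [Nat.card_congr e, Nat.card_sigma, Finset.sum_congr rfl fun y _ => h y,
    Finset.sum_ite, Finset.filter_eq' , Finset.filter_ne']
  simp [Finset.card_erase_of_mem, add_comm]

/-- The number of `2 × 2` matrices with given trace and determinant. -/
theorem card_trace_det [DecidableEq E] (t D : E) :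
    Nat.card {X : Matrix (Fin 2) (Fin 2) E // X.trace = t ∧ X.det = D} =
      Fintype.card E * (Fintype.card E - 1) +
        (Finset.univ.filter fun x : E => x * x = t * x - D).card * Fintype.card E := by
  -- The upper left entry `x` fixes the diagonal, and the off-diagonal product is then `x(t - x) -
  -- D`. This vanishes exactly when `x` is a root of the characteristic polynomial, which gives
  -- `|E|` extra solutions.
  have e : {X : Matrix (Fin 2) (Fin 2) E // X.trace = t ∧ X.det = D} ≃
      Σ x : E, {p : E × E // p.1 * p.2 = x * (t - x) - D} :=
    { toFun := fun X => ⟨X.1 0 0, (X.1 0 1, X.1 1 0), by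
        obtain ⟨X, h1, h2⟩ := X
        rw [Matrix.trace_fin_two] at h1
        rw [Matrix.det_fin_two] at h2
        simp only
        linear_combination (X 0 0) * h1 - h2⟩
      invFun := fun s => ⟨!![s.1, s.2.1.1; s.2.1.2, t - s.1], by
        obtain ⟨x, ⟨y, z⟩, h⟩ := s
        simp only at h
        constructor
        · simp [Matrix.trace_fin_two]
        · rw [Matrix.det_fin_two_of]
          linear_combination -h⟩
      left_inv := fun X => by
        obtain ⟨X, h1, h2⟩ := X
        rw [Matrix.trace_fin_two] at h1
        apply Subtype.ext
        ext i j
        fin_cases i <;> fin_cases j <;> simp [← h1]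
      right_inv := fun s => rfl }
  rw [Nat.card_congr e, Nat.card_sigma]
  simp only [card_mul_eq]
  rw [Finset.sum_add_distrib, Finset.sum_const, Finset.card_univ, smul_eq_mul, Finset.sum_ite]
  simp only [Finset.sum_const, smul_eq_mul, mul_zero, add_zero]
  congr 3
  ext x
  simp only [Finset.mem_filter, Finset.mem_univ, true_and]
  constructor <;> intro h <;> linear_combination -h

theorem card_trace_det_of_no_root {t D : E} (h : ∀ x : E, x * x ≠ t * x - D) :
    Nat.card {X : Matrix (Fin 2) (Fin 2) E // X.trace = t ∧ X.det = D} =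
      Fintype.card E * (Fintype.card E - 1) := by
  classical
  rw [card_trace_det, Finset.filter_false_of_mem fun x _ => h x]
  simp

theorem card_trace_det_of_roots {a b : E} (h : a ≠ b) :
    Nat.card {X : Matrix (Fin 2) (Fin 2) E // X.trace = a + b ∧ X.det = a * b} =
      Fintype.card E * (Fintype.card E + 1) := by
  classical
  have : (Finset.univ.filter fun x : E => x * x = (a + b) * x - a * b) = {a, b} := by
    ext x
    simp only [Finset.mem_filter, Finset.mem_univ, true_and, Finset.mem_insert,
      Finset.mem_singleton]
    constructor
    · intro hx
      have : (x - a) * (x - b) = 0 := by linear_combination hx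
      rcases mul_eq_zero.1 this with h | h
      · exact Or.inl (sub_eq_zero.1 h)
      · exact Or.inr (sub_eq_zero.1 h)
    · rintro (rfl | rfl) <;> ring
  have hq : 0 < Fintype.card E := Fintype.card_pos
  rw [card_trace_det, this, Finset.card_pair h]
  obtain ⟨n, hn⟩ := Nat.exists_eq_succ_of_ne_zero hq.ne'
  rw [hn, Nat.succ_sub_one, Nat.succ_eq_add_one]
  ring

end Count

/-! ### Scalar matrices, discriminants and rationality of eigenvalues -/

section Scalar

variable {E : Type*} [Field E]

theorem ne_smul_one_of_trace_sq_ne {X : Matrix (Fin 2) (Fin 2) E}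
    (h : X.trace ^ 2 ≠ 4 * X.det) (c : E) : X ≠ c • 1 := by
  rintro rfl
  apply h
  simp
  ring

theorem eq_zero_of_linear_eq_smul_one {X : Matrix (Fin 2) (Fin 2) E} (hX : ∀ c : E, X ≠ c • 1)
    {u w c : E} (h : u • 1 + w • X = c • (1 : Matrix (Fin 2) (Fin 2) E)) : w = 0 := by
  by_contra hw
  apply hX (w⁻¹ * (c - u))
  have : w • X = (c - u) • 1 := by rw [sub_smul, ← h]; abel
  rw [mul_smul, ← this, smul_smul, inv_mul_cancel₀ hw, one_smul]

theorem sub_smul_one_sq_eq_zero {X : Matrix (Fin 2) (Fin 2) E} {c : E}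
    (ht : X.trace = 2 * c) (hd : X.det = c ^ 2) : (X - c • 1) ^ 2 = 0 := by
  have h := sq_eq_trace_smul_sub_det X
  rw [ht, hd] at h
  rw [pow_two, sub_mul, mul_sub, mul_sub, h]
  simp only [smul_mul_assoc, mul_smul_comm, one_mul, mul_one]
  module

theorem exists_sum_eq_and_prod_eq (L : Type*) [Field L] [IsAlgClosed L] (h2 : (2 : L) ≠ 0)
    (t D : L) : ∃ α β : L, α + β = t ∧ α * β = D := by
  obtain ⟨s, hs⟩ := IsAlgClosed.exists_eq_mul_self (t ^ 2 - 4 * D)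
  refine ⟨(t + s) / 2, (t - s) / 2, ?_, ?_⟩
  · field_simp
    ring
  · field_simp
    linear_combination hs

/-- The elements of `E` already supply `|E|` roots of `X ^ |E| - X`, as many as its degree allows.
-/
theorem mem_range_algebraMap_of_pow_card_eq [Fintype E] {L : Type*} [Field L] [Algebra E L]
    {x : L} (hx : x ^ Fintype.card E = x) : ∃ y : E, algebraMap E L y = x := by
  classical
  have hne : (Polynomial.X ^ Fintype.card E - Polynomial.X : Polynomial L) ≠ 0 :=
    FiniteField.X_pow_card_sub_X_ne_zero L Fintype.one_lt_card
  have hsub : Finset.univ.image (algebraMap E L) ⊆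
      (Polynomial.X ^ Fintype.card E - Polynomial.X : Polynomial L).roots.toFinset := by
    intro z hz
    obtain ⟨y, -, rfl⟩ := Finset.mem_image.1 hz
    rw [Multiset.mem_toFinset, Polynomial.mem_roots hne]
    simp [← map_pow, FiniteField.pow_card]
  have heq := Finset.eq_of_subset_of_card_le hsub (by
    rw [Finset.card_image_of_injective _ (algebraMap E L).injective, Finset.card_univ]
    calc _ ≤ _ := Multiset.toFinset_card_le _
      _ ≤ _ := Polynomial.card_roots' _
      _ = _ := FiniteField.X_pow_card_sub_X_natDegree_eq L Fintype.one_lt_card)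
  have hx' : x ∈ (Polynomial.X ^ Fintype.card E - Polynomial.X : Polynomial L).roots.toFinset := by
    rw [Multiset.mem_toFinset, Polynomial.mem_roots hne]
    simp [hx]
  rw [← heq] at hx'
  obtain ⟨y, -, hy⟩ := Finset.mem_image.1 hx'
  exact ⟨y, hy⟩

end Scalar

/-! ### Conjugacy and element orders in PGL(2, E) -/

namespace Matrix.ProjGenLinGroup

variable {E : Type*} [Field E]

theorem mk_eq_one_iff_smul {X : GL (Fin 2) E} :
    mk X = 1 ↔ ∃ c : E, (X : Matrix (Fin 2) (Fin 2) E) = c • 1 := by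
  rw [mk_eq_one, Matrix.GeneralLinearGroup.mem_center_iff_val_mem_range_scalar]
  simp only [Set.mem_range, Matrix.scalar_apply, ← Matrix.smul_one_eq_diagonal]
  exact exists_congr fun c => eq_comm

theorem mk_eq_mk_of_smul {X Y : GL (Fin 2) E} {c : E}
    (h : (Y : Matrix (Fin 2) (Fin 2) E) = c • X) : mk X = mk Y := by
  rw [← inv_mul_eq_one, ← map_inv, ← map_mul, mk_eq_one_iff_smul]
  exact ⟨c, by rw [Units.val_mul, h, mul_smul_comm, Units.inv_mul]⟩

theorem exists_smul_of_mk_eq_mk {X Y : GL (Fin 2) E} (h : mk X = mk Y) :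
    ∃ c : E, (Y : Matrix (Fin 2) (Fin 2) E) = c • X := by
  rw [← inv_mul_eq_one, ← map_inv, ← map_mul, mk_eq_one_iff_smul] at h
  obtain ⟨c, hc⟩ := h
  refine ⟨c, ?_⟩
  have : (X : Matrix (Fin 2) (Fin 2) E) * (X⁻¹ * Y : GL (Fin 2) E).1 = Y := by
    rw [← Units.val_mul, mul_inv_cancel_left]
  rw [← this, hc, mul_smul_comm, mul_one]

/-- By Cayley-Hamilton, a trace-zero matrix has scalar square. Nonzero trace is what later fixes the
scaling of a lift. -/
theorem trace_ne_zero_of_sq_ne_one {X : GL (Fin 2) E} (h : mk X ^ 2 ≠ 1) :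
    (X : Matrix (Fin 2) (Fin 2) E).trace ≠ 0 := by
  intro ht
  apply h
  rw [← map_pow, mk_eq_one_iff_smul]
  refine ⟨-(X : Matrix (Fin 2) (Fin 2) E).det, ?_⟩
  rw [pow_two, Units.val_mul, sq_eq_trace_smul_sub_det, ht]
  simp

/-- With zero discriminant, `X = c + N` with `N ^ 2 = 0`, so `X ^ p = c ^ p` is scalar in
characteristic `p`. -/
theorem trace_sq_ne_of_pow_char_ne_one (p : ℕ) [Fact p.Prime] [CharP E p] (h2 : (2 : E) ≠ 0)
    {X : GL (Fin 2) E} (h : mk X ^ p ≠ 1) :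
    (X : Matrix (Fin 2) (Fin 2) E).trace ^ 2 ≠ 4 * (X : Matrix (Fin 2) (Fin 2) E).det := by
  intro ht
  apply h
  set c := (X : Matrix (Fin 2) (Fin 2) E).trace / 2 with hc
  have h4 : (4 : E) ≠ 0 := by
    have : (4 : E) = 2 * 2 := by norm_num
    rw [this]
    exact mul_ne_zero h2 h2
  have hN := sub_smul_one_sq_eq_zero (X := (X : Matrix (Fin 2) (Fin 2) E)) (c := c)
    (by rw [hc]; field_simp) (by
      rw [hc, div_pow, ht]
      field_simp
      norm_num)
  have hNp : ((X : Matrix (Fin 2) (Fin 2) E) - c • 1) ^ p = 0 :=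
    pow_eq_zero_of_le (Fact.out : p.Prime).two_le hN
  rw [sub_pow_char_of_commute p ((Commute.one_right _).smul_right c), smul_pow, one_pow,
    sub_eq_zero] at hNp
  rw [← map_pow, mk_eq_one_iff_smul]
  exact ⟨c ^ p, by rw [Units.val_pow_eq_pow_val, hNp]⟩

/-- Noncentral classes with nonzero trace are separated by `trace ^ 2 / det`. -/
theorem isConj_mk_of_trace_sq {X Y : GL (Fin 2) E}
    (hX : (X : Matrix (Fin 2) (Fin 2) E).trace ≠ 0) (hY : (Y : Matrix (Fin 2) (Fin 2) E).trace ≠ 0)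
    (hX' : (X : Matrix (Fin 2) (Fin 2) E).trace ^ 2 ≠ 4 * (X : Matrix (Fin 2) (Fin 2) E).det)
    (h : (X : Matrix (Fin 2) (Fin 2) E).trace ^ 2 * (Y : Matrix (Fin 2) (Fin 2) E).det =
      (Y : Matrix (Fin 2) (Fin 2) E).trace ^ 2 * (X : Matrix (Fin 2) (Fin 2) E).det) :
    IsConj (mk X) (mk Y) := by
  set c := (X : Matrix (Fin 2) (Fin 2) E).trace / (Y : Matrix (Fin 2) (Fin 2) E).trace with hc
  have hc0 : c ≠ 0 := div_ne_zero hX hY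
  have ht : (X : Matrix (Fin 2) (Fin 2) E).trace =
      (c • (Y : Matrix (Fin 2) (Fin 2) E)).trace := by
    rw [Matrix.trace_smul, smul_eq_mul, hc]
    field_simp
  have hd : (X : Matrix (Fin 2) (Fin 2) E).det = (c • (Y : Matrix (Fin 2) (Fin 2) E)).det := by
    rw [Matrix.det_smul, Fintype.card_fin, hc, div_pow]
    field_simp
    linear_combination -h
  obtain ⟨P, hP⟩ := exists_conj_of_trace_eq_of_det_eq (ne_smul_one_of_trace_sq_ne hX')
    (ne_smul_one_of_trace_sq_ne (by rw [← ht, ← hd]; exact hX')) ht hd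
  refine isConj_iff.2 ⟨mk P, ?_⟩
  rw [← map_mul, ← map_inv, ← map_mul]
  symm
  apply mk_eq_mk_of_smul (c := c)
  rw [Units.val_mul, Units.val_mul, hP, mul_assoc, Units.mul_inv, mul_one]

section Order

variable {L : Type*} [Field L] [Algebra E L]

/-- Writing `X ^ n = u + w X`, scalarity means `w = 0`, while `α ^ n - β ^ n = w (α - β)`. -/
theorem mk_pow_eq_one_iff {X : GL (Fin 2) E} {α β : L}
    (ht : α + β = algebraMap E L (X : Matrix (Fin 2) (Fin 2) E).trace)
    (hd : α * β = algebraMap E L (X : Matrix (Fin 2) (Fin 2) E).det) (hne : α ≠ β) (n : ℕ) :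
    mk X ^ n = 1 ↔ α ^ n = β ^ n := by
  have hX : (X : Matrix (Fin 2) (Fin 2) E).trace ^ 2 ≠
      4 * (X : Matrix (Fin 2) (Fin 2) E).det := by
    intro h
    have h' := congrArg (algebraMap E L) h
    simp only [map_pow, map_mul, map_ofNat, ← ht, ← hd] at h'
    have : (α - β) ^ 2 = 0 := by linear_combination h'
    exact hne (sub_eq_zero.1 (pow_eq_zero_iff two_ne_zero |>.1 this))
  have hX' := ne_smul_one_of_trace_sq_ne hX
  obtain ⟨u, w, h, hroot⟩ := exists_pow_eq_linear L (X : Matrix (Fin 2) (Fin 2) E) n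
  have hα := hroot α (by rw [← ht, ← hd]; ring)
  have hβ := hroot β (by rw [← ht, ← hd]; ring)
  rw [← map_pow, mk_eq_one_iff_smul, Units.val_pow_eq_pow_val, h]
  constructor
  · rintro ⟨c, hc⟩
    rw [hα, hβ, eq_zero_of_linear_eq_smul_one hX' hc]
    simp
  · intro hab
    rw [hα, hβ] at hab
    have : algebraMap E L w * (α - β) = 0 := by linear_combination hab
    have hw : w = 0 := by
      simpa [sub_eq_zero, hne] using this
    exact ⟨u, by rw [hw, zero_smul, add_zero]⟩

theorem orderOf_mk {X : GL (Fin 2) E} {α β : L}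
    (ht : α + β = algebraMap E L (X : Matrix (Fin 2) (Fin 2) E).trace)
    (hd : α * β = algebraMap E L (X : Matrix (Fin 2) (Fin 2) E).det) (hne : α ≠ β)
    (hβ : β ≠ 0) : orderOf (mk X) = orderOf (α / β) := by
  rw [orderOf_eq_orderOf_iff]
  intro n
  rw [mk_pow_eq_one_iff ht hd hne, div_pow, div_eq_one_iff_eq (pow_ne_zero n hβ)]

/-- The eigenvalue ratio determines the conjugacy class in `PGL(2, E)`. -/
theorem isConj_mk_pow {X Y : GL (Fin 2) E} {α β α' β' : L}
    (ht : α + β = algebraMap E L (X : Matrix (Fin 2) (Fin 2) E).trace)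
    (hd : α * β = algebraMap E L (X : Matrix (Fin 2) (Fin 2) E).det)
    (ht' : α' + β' = algebraMap E L (Y : Matrix (Fin 2) (Fin 2) E).trace)
    (hd' : α' * β' = algebraMap E L (Y : Matrix (Fin 2) (Fin 2) E).det)
    (hβ : β ≠ 0) (hβ' : β' ≠ 0) (hne' : α' ≠ β')
    (hY : (Y : Matrix (Fin 2) (Fin 2) E).trace ≠ 0) {k : ℕ} (hk : (α / β) ^ k = α' / β') :
    IsConj (mk X ^ k) (mk Y) := by
  obtain ⟨u, w, h, hroot⟩ := exists_pow_eq_linear L (X : Matrix (Fin 2) (Fin 2) E) k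
  have hα := hroot α (by rw [← ht, ← hd]; ring)
  have hβ2 := hroot β (by rw [← ht, ← hd]; ring)
  have hb : β ^ k ≠ 0 := pow_ne_zero k hβ
  have htk : algebraMap E L ((X ^ k : GL (Fin 2) E) : Matrix (Fin 2) (Fin 2) E).trace =
      α ^ k + β ^ k := by
    rw [Units.val_pow_eq_pow_val, h, hα, hβ2, Matrix.trace_add, Matrix.trace_smul,
      Matrix.trace_smul, Matrix.trace_one]
    simp only [smul_eq_mul, map_add, map_mul, ← ht, Fintype.card_fin, map_natCast]
    push_cast
    ring
  have hdk : algebraMap E L ((X ^ k : GL (Fin 2) E) : Matrix (Fin 2) (Fin 2) E).det =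
      α ^ k * β ^ k := by
    rw [Units.val_pow_eq_pow_val, Matrix.det_pow, map_pow, ← hd, mul_pow]
  have hr : α ^ k * β' = α' * β ^ k := by
    rw [div_pow, div_eq_div_iff hb hβ'] at hk
    exact hk
  have hs : α' + β' ≠ 0 := by
    rw [ht']
    simpa using hY
  rw [← map_pow]
  refine isConj_mk_of_trace_sq ?_ hY ?_ ?_
  · intro h0
    rw [h0, map_zero] at htk
    have : β ^ k * (α' + β') = 0 := by linear_combination -hr - β' * htk
    exact (mul_ne_zero hb hs) this
  · intro h0
    have h0' := congrArg (algebraMap E L) h0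
    simp only [map_pow, map_mul, map_ofNat, htk, hdk] at h0'
    have h1 : α ^ k = β ^ k := by
      have : (α ^ k - β ^ k) ^ 2 = 0 := by linear_combination h0'
      exact sub_eq_zero.1 (pow_eq_zero_iff two_ne_zero |>.1 this)
    apply hne'
    apply mul_right_cancel₀ hb
    rw [← hr, h1, mul_comm]
  -- The difference of the two sides factors as `(α ^ k α' - β ^ k β') (α ^ k β' - α' β ^ k)`, and
  -- `hr` kills the second factor.
  · apply (algebraMap E L).injective
    simp only [map_mul, map_pow, htk, hdk, ← ht', ← hd']
    linear_combination (α ^ k * α' - β ^ k * β') * hr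

end Order

end Matrix.ProjGenLinGroup

/-! ### Class sizes and powers in PGL(2, E) -/

namespace Matrix.ProjGenLinGroup

variable {E : Type*} [Field E]

/-- The class of `X` in `PGL(2, E)` is parametrized by the matrices with the trace and determinant
of `X`. -/
theorem ncard_conjugatesOf_mk {X : GL (Fin 2) E}
    (hX : (X : Matrix (Fin 2) (Fin 2) E).trace ≠ 0)
    (hX' : (X : Matrix (Fin 2) (Fin 2) E).trace ^ 2 ≠ 4 * (X : Matrix (Fin 2) (Fin 2) E).det) :
    (conjugatesOf (mk X)).ncard = Nat.card {Y : Matrix (Fin 2) (Fin 2) E //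
      Y.trace = (X : Matrix (Fin 2) (Fin 2) E).trace ∧
      Y.det = (X : Matrix (Fin 2) (Fin 2) E).det} := by
  have hX0 : (X : Matrix (Fin 2) (Fin 2) E).det ≠ 0 := Matrix.GeneralLinearGroup.det_ne_zero X
  set f : {Y : Matrix (Fin 2) (Fin 2) E // Y.trace = (X : Matrix (Fin 2) (Fin 2) E).trace ∧
      Y.det = (X : Matrix (Fin 2) (Fin 2) E).det} → ProjGenLinGroup (Fin 2) E := fun Y =>
    mk (Matrix.GeneralLinearGroup.mkOfDetNeZero Y.1 (by rw [Y.2.2]; exact hX0)) with hf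
  -- Two lifts differ by a scalar; equal nonzero traces force it to be `1`.
  have hinj : Function.Injective f := by
    rintro ⟨Y, hY1, hY2⟩ ⟨Z, hZ1, hZ2⟩ h
    obtain ⟨c, hc⟩ := exists_smul_of_mk_eq_mk h
    have hc : Z = c • Y := hc
    have : c = 1 := by
      rw [hc, Matrix.trace_smul, hY1, smul_eq_mul] at hZ1
      exact (mul_eq_right₀ hX).1 hZ1
    rw [this, one_smul] at hc
    exact Subtype.ext hc.symm
  have hrange : conjugatesOf (mk X) = Set.range f := by
    ext y
    constructor
    · intro hy
      obtain ⟨c, rfl⟩ := isConj_iff.1 hy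
      obtain ⟨C, rfl⟩ := mk_surjective c
      refine ⟨⟨((C * X * C⁻¹ : GL (Fin 2) E) : Matrix (Fin 2) (Fin 2) E), ?_, ?_⟩, ?_⟩
      · rw [Units.val_mul, Units.val_mul]
        exact Matrix.trace_units_conj C _
      · rw [Units.val_mul, Units.val_mul]
        exact Matrix.det_units_conj C _
      · simp only [hf, ← map_inv, ← map_mul]
        congr 1
        exact Units.ext rfl
    · rintro ⟨⟨Y, h1, h2⟩, rfl⟩
      apply isConj_mk_of_trace_sq hX
      · exact h1.trans_ne hX
      · exact hX'
      · change _ * Y.det = Y.trace ^ 2 * _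
        rw [h1, h2]
  rw [hrange, ← Nat.card_coe_set_eq, Nat.card_range_of_injective hinj]

section Finite

variable [Fintype E]

theorem card_mul : Nat.card (ProjGenLinGroup (Fin 2) E) * (Fintype.card E - 1) =
    (Fintype.card E ^ 2 - 1) * (Fintype.card E ^ 2 - Fintype.card E) := by
  have h := (Subgroup.center (GL (Fin 2) E)).card_eq_card_quotient_mul_card_subgroup
  have hc : Nat.card (Subgroup.center (GL (Fin 2) E)) = Fintype.card E - 1 := by
    have hinj : Function.Injective (Matrix.GeneralLinearGroup.scalar (Fin 2) (R := E)) := by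
      intro a b hab
      have := congrArg (fun M : GL (Fin 2) E => (M : Matrix (Fin 2) (Fin 2) E) 0 0) hab
      exact Units.ext (by simpa using this)
    rw [Matrix.GeneralLinearGroup.center_eq_range_scalar,
      ← Nat.card_congr (MonoidHom.ofInjective hinj).toEquiv, Nat.card_units,
      Nat.card_eq_fintype_card]
  rw [hc, Matrix.card_GL_field, Fin.prod_univ_two] at h
  simp only [Fin.val_zero, Fin.val_one, pow_zero, pow_one] at h
  exact h.symm

/-- The order and the class size of an element of `PGL(2, E)` that is neither an involution nor
unipotent. -/
theorem orderOf_dvd_and_ncard_conjugatesOf (h2 : (2 : E) ≠ 0)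
    {m : ProjGenLinGroup (Fin 2) E} (p : ℕ) [Fact p.Prime] [CharP E p]
    (hm : 2 < orderOf m) (hp : m ^ p ≠ 1) :
    (orderOf m ∣ Fintype.card E - 1 ∨ orderOf m ∣ Fintype.card E + 1) ∧
    (orderOf m ∣ Fintype.card E - 1 →
      (conjugatesOf m).ncard = Fintype.card E * (Fintype.card E + 1)) ∧
    (orderOf m ∣ Fintype.card E + 1 →
      (conjugatesOf m).ncard = Fintype.card E * (Fintype.card E - 1)) := by
  obtain ⟨X, rfl⟩ := mk_surjective m
  set q := Fintype.card E with hq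
  have hq1 : 1 < q := Fintype.one_lt_card
  have hsq : mk X ^ 2 ≠ 1 := fun h =>
    absurd (Nat.le_of_dvd two_pos (orderOf_dvd_of_pow_eq_one h)) hm.not_ge
  have hX := trace_ne_zero_of_sq_ne_one hsq
  have hX' := trace_sq_ne_of_pow_char_ne_one p h2 hp
  let L := AlgebraicClosure E
  have h2L : (2 : L) ≠ 0 := by
    rw [← map_ofNat (algebraMap E L) 2]
    exact (map_ne_zero _).2 h2
  obtain ⟨α, β, ht, hd⟩ := exists_sum_eq_and_prod_eq L h2L
    (algebraMap E L (X : Matrix (Fin 2) (Fin 2) E).trace)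
    (algebraMap E L (X : Matrix (Fin 2) (Fin 2) E).det)
  have hX0 : (X : Matrix (Fin 2) (Fin 2) E).det ≠ 0 := Matrix.GeneralLinearGroup.det_ne_zero X
  have hαβ0 : α * β ≠ 0 := by
    rw [hd]
    simpa using hX0
  have hα := left_ne_zero_of_mul hαβ0
  have hβ := right_ne_zero_of_mul hαβ0
  have hne : α ≠ β := by
    rintro rfl
    apply hX'
    apply (algebraMap E L).injective
    simp only [map_pow, map_mul, map_ofNat, ← ht, ← hd]
    ring
  have hord := orderOf_mk ht hd hne hβ
  have hzsq : (α / β) ^ 2 ≠ 1 := by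
    rw [Ne, ← orderOf_dvd_iff_pow_eq_one, ← hord, orderOf_dvd_iff_pow_eq_one]
    exact hsq
  -- Frobenius fixes the trace and determinant, hence permutes `α` and `β`. If it swaps them, `(α /
  -- β) ^ q` is the inverse of `α / β`; if it fixes them, both lie in `E`.
  set φ := FiniteField.frobeniusAlgHom E L
  have hφ : ∀ x, φ x = x ^ q := fun x => rfl
  have hφt : φ α + φ β = α + β := by rw [← map_add, ht, AlgHom.commutes]
  have hφd : φ α * φ β = α * β := by rw [← map_mul, hd, AlgHom.commutes]
  have hqsucc : q - 1 + 1 = q := Nat.sub_add_cancel hq1.le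
  have hswap : φ α = β → φ β = α → (α / β) ^ (q + 1) = 1 := by
    intro h1 h3
    rw [hφ] at h1 h3
    rw [pow_succ, div_pow, h1, h3, div_mul_div_comm, mul_comm β α, div_self hαβ0]
  have hfix : φ α = α → φ β = β → (α / β) ^ (q - 1) = 1 := by
    intro h1 h3
    rw [hφ] at h1 h3
    apply mul_right_cancel₀ (div_ne_zero hα hβ)
    rw [← pow_succ, hqsucc, div_pow, h1, h3, one_mul]
  have hcases : (φ α = α ∧ φ β = β) ∨ (φ α = β ∧ φ β = α) := by
    have : (φ α - α) * (φ α - β) = 0 := by linear_combination φ α * hφt - hφd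
    rcases mul_eq_zero.1 this with h | h
    · have h := sub_eq_zero.1 h
      exact Or.inl ⟨h, by linear_combination hφt - h⟩
    · have h := sub_eq_zero.1 h
      exact Or.inr ⟨h, by linear_combination hφt - h⟩
  have hncard := ncard_conjugatesOf_mk hX hX'
  have hnot : orderOf (mk X) ∣ q - 1 → ¬ orderOf (mk X) ∣ q + 1 := by
    intro h1 h3
    have : orderOf (mk X) ∣ 2 := by
      have := Nat.dvd_sub h3 h1
      rwa [show q + 1 - (q - 1) = 2 by omega] at this
    exact absurd (Nat.le_of_dvd two_pos this) hm.not_ge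
  refine ⟨?_, ?_, ?_⟩
  · rw [hord]
    rcases hcases with ⟨h1, h3⟩ | ⟨h1, h3⟩
    · exact Or.inl (orderOf_dvd_of_pow_eq_one (hfix h1 h3))
    · exact Or.inr (orderOf_dvd_of_pow_eq_one (hswap h1 h3))
  · intro hdvd
    have hfixed : φ α = α ∧ φ β = β := by
      rcases hcases with h | ⟨h1, h3⟩
      · exact h
      · refine absurd ?_ (hnot hdvd)
        rw [hord]
        exact orderOf_dvd_of_pow_eq_one (hswap h1 h3)
    obtain ⟨a, ha⟩ := mem_range_algebraMap_of_pow_card_eq (E := E) hfixed.1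
    obtain ⟨b, hb⟩ := mem_range_algebraMap_of_pow_card_eq (E := E) hfixed.2
    have hab : a ≠ b := by
      rintro rfl
      exact hne (ha.symm.trans hb)
    rw [← ha, ← hb, ← map_add] at ht
    rw [← ha, ← hb, ← map_mul] at hd
    rw [hncard, ← (algebraMap E L).injective ht, ← (algebraMap E L).injective hd,
      card_trace_det_of_roots hab]
  · intro hdvd
    -- An eigenvalue in `E` would be fixed by Frobenius, so the order would divide `q - 1` as well
    -- as `q + 1`, hence divide `2`.
    rw [hncard, card_trace_det_of_no_root]
    intro x hx
    have hx' := congrArg (algebraMap E L) hx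
    simp only [map_mul, map_sub, ← ht, ← hd] at hx'
    have hmem : algebraMap E L x = α ∨ algebraMap E L x = β := by
      have : (algebraMap E L x - α) * (algebraMap E L x - β) = 0 := by
        linear_combination hx'
      exact (mul_eq_zero.1 this).imp sub_eq_zero.1 sub_eq_zero.1
    have hfixed : φ α = α ∧ φ β = β := by
      rcases hmem with h | h
      · have h1 : φ α = α := by rw [← h, AlgHom.commutes]
        exact ⟨h1, by linear_combination hφt - h1⟩
      · have h1 : φ β = β := by rw [← h, AlgHom.commutes]
        exact ⟨by linear_combination hφt - h1, h1⟩
    refine hnot ?_ hdvd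
    rw [hord]
    exact orderOf_dvd_of_pow_eq_one (hfix hfixed.1 hfixed.2)

end Finite

/-- Elements of the same order generate conjugate subgroups, if they are neither involutions nor
unipotent. -/
theorem exists_isConj_pow (h2 : (2 : E) ≠ 0) {m n : ProjGenLinGroup (Fin 2) E} (p : ℕ)
    [Fact p.Prime] [CharP E p] (hm : 2 < orderOf m) (hmn : orderOf n = orderOf m)
    (hp : m ^ p ≠ 1) :
    (∃ k : ℕ, IsConj (m ^ k) n) ∧ IsConj m m⁻¹ := by
  obtain ⟨X, rfl⟩ := mk_surjective m
  obtain ⟨Y, rfl⟩ := mk_surjective n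
  let L := AlgebraicClosure E
  have h2L : (2 : L) ≠ 0 := by
    rw [← map_ofNat (algebraMap E L) 2]
    exact (map_ne_zero _).2 h2
  have key : ∀ Z : GL (Fin 2) E, orderOf (mk Z) = orderOf (mk X) →
      (Z : Matrix (Fin 2) (Fin 2) E).trace ≠ 0 ∧ ∃ α β : L,
        α + β = algebraMap E L (Z : Matrix (Fin 2) (Fin 2) E).trace ∧
        α * β = algebraMap E L (Z : Matrix (Fin 2) (Fin 2) E).det ∧
        α ≠ β ∧ α ≠ 0 ∧ β ≠ 0 := by
    intro Z hZ
    have hsq : mk Z ^ 2 ≠ 1 := fun h =>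
      absurd (Nat.le_of_dvd two_pos (orderOf_dvd_of_pow_eq_one h)) (hZ ▸ hm.not_ge)
    have hpZ : mk Z ^ p ≠ 1 := by
      rw [Ne, ← orderOf_dvd_iff_pow_eq_one, hZ, orderOf_dvd_iff_pow_eq_one]
      exact hp
    obtain ⟨α, β, ht, hd⟩ := exists_sum_eq_and_prod_eq L h2L
      (algebraMap E L (Z : Matrix (Fin 2) (Fin 2) E).trace)
      (algebraMap E L (Z : Matrix (Fin 2) (Fin 2) E).det)
    have hαβ0 : α * β ≠ 0 := by
      rw [hd]
      simpa using Matrix.GeneralLinearGroup.det_ne_zero Z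
    refine ⟨trace_ne_zero_of_sq_ne_one hsq, α, β, ht, hd, ?_, left_ne_zero_of_mul hαβ0,
      right_ne_zero_of_mul hαβ0⟩
    rintro rfl
    apply trace_sq_ne_of_pow_char_ne_one p h2 hpZ
    apply (algebraMap E L).injective
    simp only [map_pow, map_mul, map_ofNat, ← ht, ← hd]
    ring
  obtain ⟨hX, α, β, ht, hd, hne, hα, hβ⟩ := key X rfl
  obtain ⟨hY, α', β', ht', hd', hne', hα', hβ'⟩ := key Y hmn
  have hord := orderOf_mk ht hd hne hβ
  have hord' := orderOf_mk ht' hd' hne' hβ'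
  have hpos : orderOf (mk X) ≠ 0 := by omega
  constructor
  · have : NeZero (orderOf (mk X)) := ⟨hpos⟩
    -- All roots of unity of this order are powers of `α / β`, in particular the eigenvalue ratio of
    -- `Y`.
    have h1 : IsPrimitiveRoot (α / β) (orderOf (mk X)) := hord ▸ IsPrimitiveRoot.orderOf _
    obtain ⟨k, -, hk⟩ := h1.eq_pow_of_pow_eq_one (ξ := α' / β') (by
      rw [← hmn, hord', pow_orderOf_eq_one])
    exact ⟨k, isConj_mk_pow ht hd ht' hd' hβ hβ' hne' hY hk⟩
  -- Conjugacy with the inverse: inverting the ratio only interchanges the two eigenvalues of the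
  -- same `X`.
  · have hk : (α / β) ^ (orderOf (mk X) - 1) = β / α := by
      have h1 : (α / β) ^ (orderOf (mk X) - 1) * (α / β) = 1 := by
        rw [← pow_succ, Nat.sub_add_cancel (Nat.one_le_iff_ne_zero.2 hpos), hord,
          pow_orderOf_eq_one]
      rw [eq_div_iff hα]
      rw [mul_div_assoc', div_eq_one_iff_eq hβ] at h1
      exact h1
    have h1 := isConj_mk_pow ht hd ((add_comm β α).trans ht) ((mul_comm β α).trans hd) hβ hα
      hne.symm hX hk
    have h3 : mk X ^ (orderOf (mk X) - 1) = (mk X)⁻¹ := by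
      rw [eq_inv_iff_mul_eq_one, ← pow_succ,
        Nat.sub_add_cancel (Nat.one_le_iff_ne_zero.2 hpos), pow_orderOf_eq_one]
    rw [h3] at h1
    exact h1.symm

end Matrix.ProjGenLinGroup

/-! ### Semisimple classes and centralizers in PSL(2, K) -/

namespace Matrix.ProjectiveSpecialLinearGroup

variable {K : Type*} [Field K]

theorem mk_eq_mk_iff_smul {A B : SpecialLinearGroup (Fin 2) K} :
    (QuotientGroup.mk A : ProjectiveSpecialLinearGroup (Fin 2) K) = QuotientGroup.mk B ↔
      ∃ r : K, r * r = 1 ∧ (B : Matrix (Fin 2) (Fin 2) K) = r • (A : Matrix (Fin 2) (Fin 2) K) := by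
  rw [QuotientGroup.eq, Matrix.SpecialLinearGroup.mem_center_iff]
  simp only [Fintype.card_fin, pow_two, Matrix.scalar_apply, ← Matrix.smul_one_eq_diagonal]
  refine exists_congr fun r => and_congr_right fun hr => ?_
  constructor
  · intro h
    have : (B : Matrix (Fin 2) (Fin 2) K) = A * (A⁻¹ * B : SpecialLinearGroup (Fin 2) K) := by
      rw [← Matrix.SpecialLinearGroup.coe_mul, mul_inv_cancel_left]
    rw [this, ← h, mul_smul_comm, mul_one]
  · intro h
    rw [Matrix.SpecialLinearGroup.coe_mul, h, mul_smul_comm, ← Matrix.SpecialLinearGroup.coe_mul,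
      inv_mul_cancel, Matrix.SpecialLinearGroup.coe_one]

theorem mk_eq_one_iff_smul {A : SpecialLinearGroup (Fin 2) K} :
    (QuotientGroup.mk A : ProjectiveSpecialLinearGroup (Fin 2) K) = 1 ↔
      ∃ r : K, r * r = 1 ∧ (A : Matrix (Fin 2) (Fin 2) K) = r • 1 := by
  rw [← QuotientGroup.mk_one, eq_comm, mk_eq_mk_iff_smul, Matrix.SpecialLinearGroup.coe_one]

/-- Subtracting a scalar preserves semisimplicity, and a semisimple nilpotent map is zero. -/
theorem eq_smul_one_of_isSemisimple {X : Matrix (Fin 2) (Fin 2) K}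
    (h : Module.End.IsSemisimple (Matrix.toLin' X)) {c : K} {n : ℕ} (hn : (X - c • 1) ^ n = 0) :
    X = c • 1 := by
  have h1 : Module.End.IsSemisimple
      (Matrix.toLin' X - algebraMap K (Module.End K (Fin 2 → K)) c) :=
    Module.End.isSemisimple_sub_algebraMap_iff.2 h
  have e : Matrix.toLin' X - algebraMap K (Module.End K (Fin 2 → K)) c =
      Matrix.toLinAlgEquiv' (X - c • 1) := by
    rw [map_sub, map_smul, map_one, Algebra.algebraMap_eq_smul_one]
    rfl
  rw [e] at h1
  have h2 := Module.End.eq_zero_of_isNilpotent_isSemisimple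
    ⟨n, by rw [← map_pow, hn, map_zero]⟩ h1
  rw [map_eq_zero_iff _ Matrix.toLinAlgEquiv'.injective] at h2
  exact sub_eq_zero.1 h2

theorem trace_ne_zero_of_sq_ne_one {A : SpecialLinearGroup (Fin 2) K}
    (h : (QuotientGroup.mk A : ProjectiveSpecialLinearGroup (Fin 2) K) ^ 2 ≠ 1) :
    (A : Matrix (Fin 2) (Fin 2) K).trace ≠ 0 := by
  intro ht
  apply h
  rw [← QuotientGroup.mk_pow, mk_eq_one_iff_smul]
  refine ⟨-1, by ring, ?_⟩
  rw [pow_two, Matrix.SpecialLinearGroup.coe_mul, sq_eq_trace_smul_sub_det, ht, A.det_coe]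
  simp

theorem trace_sq_ne_four_of_isSemisimple (h2 : (2 : K) ≠ 0) {A : SpecialLinearGroup (Fin 2) K}
    (hA : Module.End.IsSemisimple (Matrix.toLin' (A : Matrix (Fin 2) (Fin 2) K)))
    (h : (QuotientGroup.mk A : ProjectiveSpecialLinearGroup (Fin 2) K) ≠ 1) :
    (A : Matrix (Fin 2) (Fin 2) K).trace ^ 2 ≠ 4 := by
  intro ht
  apply h
  have h4 : (2 : K) ^ 2 ≠ 0 := pow_ne_zero 2 h2
  have hsq : ((A : Matrix (Fin 2) (Fin 2) K).trace / 2) ^ 2 = 1 := by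
    rw [div_pow, ht, div_eq_one_iff_eq h4]
    norm_num
  refine mk_eq_one_iff_smul.2 ⟨(A : Matrix (Fin 2) (Fin 2) K).trace / 2, by rw [← pow_two, hsq], ?_⟩
  refine eq_smul_one_of_isSemisimple hA (n := 2) (sub_smul_one_sq_eq_zero (by field_simp) ?_)
  rw [hsq, A.det_coe]

/-- If `A ^ p = r` with `r = ±1`, then `r ^ p = r` and `(A - r) ^ p = A ^ p - r ^ p = 0`. So
nontrivial semisimple elements meet the hypothesis `m ^ p ≠ 1` of the `PGL` lemmas. -/
theorem eq_one_of_pow_char_eq_one (p : ℕ) [Fact p.Prime] [CharP K p]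
    {A : SpecialLinearGroup (Fin 2) K}
    (hA : Module.End.IsSemisimple (Matrix.toLin' (A : Matrix (Fin 2) (Fin 2) K)))
    (h : (QuotientGroup.mk A : ProjectiveSpecialLinearGroup (Fin 2) K) ^ p = 1) :
    (QuotientGroup.mk A : ProjectiveSpecialLinearGroup (Fin 2) K) = 1 := by
  rw [← QuotientGroup.mk_pow, mk_eq_one_iff_smul] at h
  obtain ⟨r, hr, hA'⟩ := h
  have hrp : r ^ p = r ∨ p = 2 := by
    rcases (Fact.out : p.Prime).eq_two_or_odd' with h | ⟨n, h⟩
    · exact Or.inr h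
    · left
      rw [h, pow_succ, pow_mul, pow_two, hr, one_pow, one_mul]
  have hrp : r ^ p = r := by
    rcases hrp with h | h
    · exact h
    · have hchar : CharP K 2 := h ▸ (inferInstance : CharP K p)
      have h1 : r = 1 := by
        have h0 : (2 : K) = 0 := by exact_mod_cast CharP.cast_eq_zero K 2
        have : (r - 1) * (r - 1) = 0 := by linear_combination hr + (1 - r) * h0
        simpa [sub_eq_zero] using this
      rw [h1, one_pow]
  refine mk_eq_one_iff_smul.2 ⟨r, hr, eq_smul_one_of_isSemisimple hA (n := p) ?_⟩
  rw [sub_pow_char_of_commute p ((Commute.one_right _).smul_right r), smul_pow, one_pow, hrp,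
    ← Matrix.SpecialLinearGroup.coe_pow, hA', sub_self]

/-- If the order of `A` in `PSL(2, K)` divides `(|K| - 1) / 2`, then `A` is diagonalizable over
`K`. -/
theorem exists_eigenvalues [Fintype K] (h2 : (2 : K) ≠ 0) {A : SpecialLinearGroup (Fin 2) K}
    (hA : (A : Matrix (Fin 2) (Fin 2) K).trace ^ 2 ≠ 4) {d : ℕ}
    (hd : (QuotientGroup.mk A : ProjectiveSpecialLinearGroup (Fin 2) K) ^ d = 1)
    (hdvd : 2 * d ∣ Fintype.card K - 1) :
    ∃ a b : K, a ≠ b ∧ a * b = 1 ∧ (A : Matrix (Fin 2) (Fin 2) K).trace = a + b := by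
  let L := AlgebraicClosure K
  have h2L : (2 : L) ≠ 0 := by
    rw [← map_ofNat (algebraMap K L) 2]
    exact (map_ne_zero _).2 h2
  obtain ⟨α, β, ht, hαβ⟩ := exists_sum_eq_and_prod_eq L h2L
    (algebraMap K L (A : Matrix (Fin 2) (Fin 2) K).trace) 1
  have hA' : (A : Matrix (Fin 2) (Fin 2) K).trace ^ 2 ≠
      4 * (A : Matrix (Fin 2) (Fin 2) K).det := by
    rwa [A.det_coe, mul_one]
  obtain ⟨u, w, h, hroot⟩ := exists_pow_eq_linear L (A : Matrix (Fin 2) (Fin 2) K) d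
  rw [A.det_coe, map_one] at hroot
  rw [← QuotientGroup.mk_pow, mk_eq_one_iff_smul, Matrix.SpecialLinearGroup.coe_pow, h] at hd
  obtain ⟨r, hr, hd⟩ := hd
  have hw := eq_zero_of_linear_eq_smul_one (ne_smul_one_of_trace_sq_ne hA') hd
  have hu : u = r := by
    have := congrFun (congrFun hd 0) 0
    simpa [hw] using this
  have key : ∀ x : L, x * x = algebraMap K L (A : Matrix (Fin 2) (Fin 2) K).trace * x - 1 →
      ∃ y : K, algebraMap K L y = x := by
    intro x hx
    apply mem_range_algebraMap_of_pow_card_eq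
    have h1 := hroot x hx
    rw [hw, hu, map_zero, zero_mul, add_zero] at h1
    -- Each eigenvalue satisfies `x ^ d = r = ±1`; the factor `2` in `2 * d` absorbs the sign, so `x
    -- ^ (|K| - 1) = 1`.
    obtain ⟨e, he⟩ := hdvd
    have h3 : x ^ (Fintype.card K - 1) = 1 := by
      rw [he, pow_mul, mul_comm 2 d, pow_mul, h1, pow_two, ← map_mul, hr, map_one, one_pow]
    rw [← Nat.sub_add_cancel (Fintype.card_pos (α := K)), pow_succ, h3, one_mul]
  obtain ⟨a, ha⟩ := key α (by rw [← ht, ← hαβ]; ring)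
  obtain ⟨b, hb⟩ := key β (by rw [← ht, ← hαβ]; ring)
  rw [← ha, ← hb, ← map_add] at ht
  rw [← ha, ← hb, ← map_mul, ← map_one (algebraMap K L)] at hαβ
  have ht' := (algebraMap K L).injective ht
  have hab := (algebraMap K L).injective hαβ
  refine ⟨a, b, ?_, hab, ht'.symm⟩
  rintro rfl
  apply hA
  rw [← ht']
  linear_combination 4 * hab

theorem trace_conj (C A : SpecialLinearGroup (Fin 2) K) :
    ((C * A * C⁻¹ : SpecialLinearGroup (Fin 2) K) : Matrix (Fin 2) (Fin 2) K).trace =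
      (A : Matrix (Fin 2) (Fin 2) K).trace := by
  rw [Matrix.SpecialLinearGroup.coe_mul, Matrix.trace_mul_comm,
    ← Matrix.SpecialLinearGroup.coe_mul, inv_mul_cancel_left]

/-- Diagonalizable elements of `SL(2, K)` with the same trace, not `±2`, are conjugate. -/
theorem isConj_of_trace_eq {A B : SpecialLinearGroup (Fin 2) K} {a b : K} (hab : a ≠ b)
    (hab1 : a * b = 1) (hA : (A : Matrix (Fin 2) (Fin 2) K).trace = a + b)
    (hB : (B : Matrix (Fin 2) (Fin 2) K).trace = a + b) : IsConj A B := by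
  have hns : ∀ C : SpecialLinearGroup (Fin 2) K, (C : Matrix (Fin 2) (Fin 2) K).trace = a + b →
      ∀ c : K, (C : Matrix (Fin 2) (Fin 2) K) ≠ c • 1 := by
    intro C hC
    apply ne_smul_one_of_trace_sq_ne
    rw [hC, C.det_coe]
    intro h
    have : (a - b) ^ 2 = 0 := by linear_combination h - 4 * hab1
    exact hab (sub_eq_zero.1 (pow_eq_zero_iff two_ne_zero |>.1 this))
  obtain ⟨P, hP⟩ := exists_conj_of_trace_eq_of_det_eq (hns A hA) (hns B hB) (hA.trans hB.symm)
    (A.det_coe.trans B.det_coe.symm)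
  have hP0 : (P : Matrix (Fin 2) (Fin 2) K).det ≠ 0 := Matrix.GeneralLinearGroup.det_ne_zero P
  have hsub : a - b ≠ 0 := sub_ne_zero.2 hab
  set e := ((P : Matrix (Fin 2) (Fin 2) K).det)⁻¹ with he
  -- A conjugating matrix in `GL` must be corrected to determinant `1`. `S = 1 + w (A - b)` commutes
  -- with `A` and has eigenvalues `e` and `1`, so `P * S` has determinant `1` and conjugates in the
  -- same way.
  set w := (e - 1) / (a - b) with hw
  set S : Matrix (Fin 2) (Fin 2) K := (1 - w * b) • 1 + w • (A : Matrix (Fin 2) (Fin 2) K) with hS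
  have hwab : w * (a - b) = e - 1 := div_mul_cancel₀ _ hsub
  have hSdet : S.det = e := by
    have h1 := A.det_coe
    rw [Matrix.det_fin_two] at h1
    rw [Matrix.trace_fin_two] at hA
    rw [hS, Matrix.det_fin_two]
    simp only [Matrix.add_apply, Matrix.smul_apply, smul_eq_mul, Matrix.one_apply_eq, ne_eq,
      zero_ne_one, one_ne_zero, not_false_eq_true, Matrix.one_apply_ne, mul_one, mul_zero, zero_add]
    linear_combination w ^ 2 * h1 + (1 - w * b) * w * hA + hwab - w ^ 2 * hab1
  have hSA : S * A = A * S := by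
    rw [hS, add_mul, mul_add, smul_mul_assoc, smul_mul_assoc, mul_smul_comm, mul_smul_comm,
      one_mul, mul_one]
  obtain ⟨R, hR⟩ : ∃ R : SpecialLinearGroup (Fin 2) K,
      (R : Matrix (Fin 2) (Fin 2) K) = (P : Matrix (Fin 2) (Fin 2) K) * S :=
    ⟨⟨(P : Matrix (Fin 2) (Fin 2) K) * S, by
      rw [Matrix.det_mul, hSdet, he, mul_inv_cancel₀ hP0]⟩, rfl⟩
  refine isConj_iff.2 ⟨R, ?_⟩
  · rw [mul_inv_eq_iff_eq_mul]
    apply Subtype.ext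
    rw [Matrix.SpecialLinearGroup.coe_mul, Matrix.SpecialLinearGroup.coe_mul]
    rw [hR, mul_assoc, hSA, ← mul_assoc, hP, mul_assoc]

theorem ncard_conjugatesOf_mk [Fintype K] {A : SpecialLinearGroup (Fin 2) K}
    (hA0 : (A : Matrix (Fin 2) (Fin 2) K).trace ≠ 0) {a b : K} (hab : a ≠ b)
    (hab1 : a * b = 1) (hA : (A : Matrix (Fin 2) (Fin 2) K).trace = a + b) :
    (conjugatesOf (QuotientGroup.mk A : ProjectiveSpecialLinearGroup (Fin 2) K)).ncard =
      Fintype.card K * (Fintype.card K + 1) := by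
  rw [← card_trace_det_of_roots hab]
  set f : {Y : Matrix (Fin 2) (Fin 2) K // Y.trace = a + b ∧ Y.det = a * b} →
    ProjectiveSpecialLinearGroup (Fin 2) K := fun Y =>
      QuotientGroup.mk (⟨Y.1, Y.2.2.trans hab1⟩ : SpecialLinearGroup (Fin 2) K) with hf
  have hinj : Function.Injective f := by
    rintro ⟨Y, hY1, hY2⟩ ⟨Z, hZ1, hZ2⟩ h
    obtain ⟨r, -, hr⟩ := mk_eq_mk_iff_smul.1 h
    have hr : Z = r • Y := hr
    have : r = 1 := by
      rw [hr, Matrix.trace_smul, hY1, smul_eq_mul] at hZ1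
      exact (mul_eq_right₀ (hA ▸ hA0)).1 hZ1
    rw [this, one_smul] at hr
    exact Subtype.ext hr.symm
  have hrange : conjugatesOf (QuotientGroup.mk A : ProjectiveSpecialLinearGroup (Fin 2) K) =
      Set.range f := by
    ext y
    constructor
    · intro hy
      obtain ⟨c, rfl⟩ := isConj_iff.1 hy
      obtain ⟨C, rfl⟩ := QuotientGroup.mk_surjective c
      refine ⟨⟨((C * A * C⁻¹ : SpecialLinearGroup (Fin 2) K) : Matrix (Fin 2) (Fin 2) K), ?_, ?_⟩,
        rfl⟩
      · exact (trace_conj C A).trans hA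
      · rw [hab1]
        exact Matrix.SpecialLinearGroup.det_coe _
    · rintro ⟨⟨Y, h1, h2⟩, rfl⟩
      exact MonoidHom.map_isConj
        (QuotientGroup.mk' (Subgroup.center (SpecialLinearGroup (Fin 2) K)))
        (isConj_of_trace_eq (B := ⟨Y, h2.trans hab1⟩) hab hab1 hA h1)
  rw [hrange, ← Nat.card_coe_set_eq, Nat.card_range_of_injective hinj]

/-- Distinct tori meet trivially. -/
theorem eq_or_eq_inv_of_commute (h2 : (2 : K) ≠ 0) {A : SpecialLinearGroup (Fin 2) K}
    (hA0 : (A : Matrix (Fin 2) (Fin 2) K).trace ≠ 0)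
    (hA4 : (A : Matrix (Fin 2) (Fin 2) K).trace ^ 2 ≠ 4)
    {y t : ProjectiveSpecialLinearGroup (Fin 2) K} (hy : IsConj (QuotientGroup.mk A) y)
    (htA : Commute t (QuotientGroup.mk A)) (hty : Commute t y) (ht : t ≠ 1) :
    y = QuotientGroup.mk A ∨ y = (QuotientGroup.mk A)⁻¹ := by
  obtain ⟨c, rfl⟩ := isConj_iff.1 hy
  obtain ⟨C, rfl⟩ := QuotientGroup.mk_surjective c
  obtain ⟨S, rfl⟩ := QuotientGroup.mk_surjective t
  set Y : SpecialLinearGroup (Fin 2) K := C * A * C⁻¹ with hY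
  have hmkY : (QuotientGroup.mk C * QuotientGroup.mk A * (QuotientGroup.mk C)⁻¹ :
    ProjectiveSpecialLinearGroup (Fin 2) K) = QuotientGroup.mk Y := rfl
  rw [hmkY] at hty ⊢
  have hYtr : (Y : Matrix (Fin 2) (Fin 2) K).trace = (A : Matrix (Fin 2) (Fin 2) K).trace := by
    rw [hY, trace_conj]
  -- Commuting in `PSL` means commuting up to a sign, and a nonzero trace rules out the minus sign.
  have lift : ∀ Z : SpecialLinearGroup (Fin 2) K, (Z : Matrix (Fin 2) (Fin 2) K).trace ≠ 0 →
      Commute (QuotientGroup.mk S : ProjectiveSpecialLinearGroup (Fin 2) K) (QuotientGroup.mk Z) →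
      (S : Matrix (Fin 2) (Fin 2) K) * Z = Z * S := by
    intro Z hZ h
    have h' : (QuotientGroup.mk Z : ProjectiveSpecialLinearGroup (Fin 2) K) =
        QuotientGroup.mk (S * Z * S⁻¹) := (mul_inv_eq_iff_eq_mul.2 h).symm
    obtain ⟨r, -, hr⟩ := mk_eq_mk_iff_smul.1 h'
    have hr1 : r = 1 := by
      have := congrArg Matrix.trace hr
      rw [trace_conj, Matrix.trace_smul, smul_eq_mul] at this
      exact (mul_eq_right₀ hZ).1 this.symm
    rw [hr1, one_smul] at hr
    have h3 : S * Z = Z * S := by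
      rw [← mul_inv_eq_iff_eq_mul]
      exact Subtype.ext hr
    exact congrArg Subtype.val h3
  have hSA := lift A hA0 htA
  have hSY := lift Y (hYtr ▸ hA0) hty
  have hAns : ∀ c : K, (A : Matrix (Fin 2) (Fin 2) K) ≠ c • 1 :=
    ne_smul_one_of_trace_sq_ne (by rwa [A.det_coe, mul_one])
  have hSns : ∀ c : K, (S : Matrix (Fin 2) (Fin 2) K) ≠ c • 1 := by
    intro c hc
    refine ht (mk_eq_one_iff_smul.2 ⟨c, ?_, hc⟩)
    have := S.det_coe
    rw [hc] at this
    simpa [pow_two] using this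
  obtain ⟨u, w, hS⟩ := exists_eq_linear_of_commute hAns hSA
  obtain ⟨u', w', hYS⟩ := exists_eq_linear_of_commute hSns hSY.symm
  -- `Y` is a polynomial in `S` and `S` one in `A`, so `Y = u + w A`. Equal trace and determinant
  -- then give `w = ±1`, that is, `Y = A` or `Y = tr A - A = A⁻¹`.
  obtain ⟨u, w, hYA⟩ : ∃ u w : K, (Y : Matrix (Fin 2) (Fin 2) K) = u • 1 + w • A.1 :=
    ⟨u' + w' * u, w' * w, by rw [hYS, hS]; module⟩
  have htr := hYtr
  have hdet := Y.det_coe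
  have hdetA := A.det_coe
  rw [hYA] at htr hdet
  rw [Matrix.det_fin_two] at hdet hdetA
  rw [Matrix.trace_fin_two] at hA4
  rw [Matrix.trace_fin_two, Matrix.trace_fin_two] at htr
  simp only [Matrix.add_apply, Matrix.smul_apply, smul_eq_mul, Matrix.one_apply_eq, ne_eq,
    zero_ne_one, one_ne_zero, not_false_eq_true, Matrix.one_apply_ne, mul_one, mul_zero,
    zero_add] at htr hdet
  have hw : (w - 1) * (w + 1) = 0 := by
    have : ((A.1 0 0 + A.1 1 1) ^ 2 - 4) * ((w - 1) * (w + 1)) = 0 := by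
      linear_combination (2 * u + w * (A.1 0 0 + A.1 1 1) + (A.1 0 0 + A.1 1 1)) * htr
        - 4 * hdet + 4 * w ^ 2 * hdetA
    exact (mul_eq_zero.1 this).resolve_left (sub_ne_zero.2 hA4)
  rcases mul_eq_zero.1 hw with hw | hw
  · left
    have hw : w = 1 := sub_eq_zero.1 hw
    have hu : u = 0 := by
      apply (mul_eq_zero.1 (?_ : 2 * u = 0)).resolve_left h2
      rw [hw] at htr
      linear_combination htr
    congr 1
    apply Subtype.ext
    rw [hYA, hu, hw, zero_smul, zero_add, one_smul]
  · right
    have hw : w = -1 := eq_neg_of_add_eq_zero_left hw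
    have hu : u = (A : Matrix (Fin 2) (Fin 2) K).trace := by
      apply mul_left_cancel₀ h2
      rw [hw] at htr
      rw [Matrix.trace_fin_two]
      linear_combination htr
    have hYA1 : Y * A = 1 := by
      apply Subtype.ext
      rw [Matrix.SpecialLinearGroup.coe_mul, hYA, hu, hw, add_mul, smul_mul_assoc, smul_mul_assoc,
        one_mul, sq_eq_trace_smul_sub_det, A.det_coe, Matrix.SpecialLinearGroup.coe_one]
      module
    rw [eq_inv_of_mul_eq_one_left hYA1]
    rfl

theorem card_mul [Fintype K] (h2 : (2 : K) ≠ 0) :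
    Nat.card (ProjectiveSpecialLinearGroup (Fin 2) K) * 2 * (Fintype.card K - 1) =
      (Fintype.card K ^ 2 - 1) * (Fintype.card K ^ 2 - Fintype.card K) := by
  have hSL : Nat.card (SpecialLinearGroup (Fin 2) K) * (Fintype.card K - 1) =
      (Fintype.card K ^ 2 - 1) * (Fintype.card K ^ 2 - Fintype.card K) := by
    have h := (Matrix.GeneralLinearGroup.det : GL (Fin 2) K →* Kˣ).ker.card_mul_index
    rw [Subgroup.index_ker, MonoidHom.range_eq_top.2 Matrix.GeneralLinearGroup.det_surjective,
      Subgroup.card_top, Nat.card_units, Nat.card_eq_fintype_card (α := K),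
      Matrix.card_GL_field, Fin.prod_univ_two] at h
    simp only [Fin.val_zero, Fin.val_one, pow_zero, pow_one] at h
    rw [← h]
    congr 1
    refine Nat.card_congr
      { toFun := fun A => ⟨Matrix.SpecialLinearGroup.toGL A, ?_⟩
        invFun := fun X => ⟨X.1.1, ?_⟩
        left_inv := fun A => rfl
        right_inv := fun X => Subtype.ext (Units.ext rfl) }
    · exact Units.ext A.det_coe
    · exact congrArg Units.val X.2
  have hcenter : Nat.card (Subgroup.center (SpecialLinearGroup (Fin 2) K)) = 2 := by
    have hne : NeZero (2 : K) := ⟨h2⟩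
    have e := Matrix.SpecialLinearGroup.center_equiv_rootsOfUnity (n := Fin 2) (R := K)
    rw [Nat.card_congr e.toEquiv]
    have : max (Fintype.card (Fin 2)) 1 = 2 := by simp
    rw [this]
    have hp : IsPrimitiveRoot (-1 : K) 2 := IsPrimitiveRoot.mk_of_lt _ two_pos (by ring)
      fun l h0 hl => by
        have : l = 1 := by omega
        subst this
        rw [pow_one]
        intro h
        apply h2
        linear_combination -h
    exact hp.card_rootsOfUnity
  have h := (Subgroup.center (SpecialLinearGroup (Fin 2) K)).card_eq_card_quotient_mul_card_subgroup
  rw [hcenter] at h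
  rw [← h, hSL]

end Matrix.ProjectiveSpecialLinearGroup

end

/-! ### Incidence structures, the sets `I_x` and reduction -/

section Design

variable {α : Type*}

theorem ncard_eq_mul_ncard_image {β : Type*} (f : α → β) {s : Set α} (hs : s.Finite) {n : ℕ}
    (h : ∀ x ∈ s, {y ∈ s | f y = f x}.ncard = n) : s.ncard = n * (f '' s).ncard := by
  classical
  lift s to Finset α using hs
  rw [← Finset.coe_image, Set.ncard_coe_finset, Set.ncard_coe_finset,
    Finset.card_eq_sum_card_image f s, Finset.sum_const_nat (m := n), mul_comm]
  intro b hb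
  obtain ⟨x, hx, rfl⟩ := Finset.mem_image.1 hb
  rw [← h x (by simpa using hx), ← Set.ncard_coe_finset]
  simp

/-- Counting incident point-block pairs in two ways. -/
theorem card_points_mul_eq_card_blocks_mul {P : Set α} {B : Set (Set α)} (hP : P.Finite)
    (hB : B.Finite) {k l : ℕ} (hsub : ∀ b ∈ B, b ⊆ P) (hk : ∀ b ∈ B, b.ncard = k)
    (hl : ∀ x ∈ P, {b ∈ B | x ∈ b}.ncard = l) : P.ncard * l = B.ncard * k := by
  classical
  lift P to Finset α using hP
  lift B to Finset (Set α) using hB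
  have h := Finset.sum_card_bipartiteAbove_eq_sum_card_bipartiteBelow (s := P) (t := B)
    (r := fun x b => x ∈ b)
  rw [Finset.sum_const_nat (m := l), Finset.sum_const_nat (m := k)] at h
  · simpa using h
  · intro b hb
    rw [← hk b (by simpa using hb), ← Set.ncard_coe_finset]
    congr 1
    ext x
    simp only [Finset.bipartiteBelow, Finset.coe_filter, Set.mem_ofPred_eq]
    exact ⟨fun h => h.2, fun h => ⟨by simpa using hsub b (by simpa using hb) h, h⟩⟩
  · intro x hx
    rw [← hl x (by simpa using hx), ← Set.ncard_coe_finset]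
    congr 1
    ext b
    simp [Finset.bipartiteAbove]

theorem mem_pointIntersection_self (B : Set (Set α)) (x : α) : x ∈ pointIntersection B x :=
  fun _ hb => hb.2

theorem pointIntersection_subset {B : Set (Set α)} {x : α} {b : Set α} (hb : b ∈ B)
    (hx : x ∈ b) : pointIntersection B x ⊆ b :=
  Set.sInter_subset_of_mem ⟨hb, hx⟩

/-- Automorphisms of the block set carry the blocks through a point to those through its image.
Applied to conjugations, this makes replication numbers and the sizes of the `I_x` constant on a
class. -/
theorem blocksThrough_apply {B : Set (Set α)} (σ : Equiv.Perm α)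
    (hσ : ∀ b, σ '' b ∈ B ↔ b ∈ B) (x : α) :
    {b ∈ B | σ x ∈ b} = (fun b => σ '' b) '' {b ∈ B | x ∈ b} := by
  ext b
  constructor
  · rintro ⟨hb, hx⟩
    have e : σ '' (σ ⁻¹' b) = b := Set.image_preimage_eq b σ.surjective
    exact ⟨σ ⁻¹' b, ⟨(hσ _).1 (e.symm ▸ hb), hx⟩, e⟩
  · rintro ⟨b, ⟨hb, hx⟩, rfl⟩
    exact ⟨(hσ b).2 hb, Set.mem_image_of_mem σ hx⟩

theorem ncard_blocksThrough_apply {B : Set (Set α)} (σ : Equiv.Perm α)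
    (hσ : ∀ b, σ '' b ∈ B ↔ b ∈ B) (x : α) :
    {b ∈ B | σ x ∈ b}.ncard = {b ∈ B | x ∈ b}.ncard := by
  rw [blocksThrough_apply σ hσ, Set.ncard_image_of_injective _ σ.injective.image_injective]

theorem pointIntersection_apply {B : Set (Set α)} (σ : Equiv.Perm α)
    (hσ : ∀ b, σ '' b ∈ B ↔ b ∈ B) (x : α) :
    pointIntersection B (σ x) = σ '' pointIntersection B x := by
  unfold pointIntersection
  rw [blocksThrough_apply σ hσ, Set.sInter_image, Set.sInter_eq_biInter,
    Set.image_iInter₂ σ.bijective]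

/-- In a `1`-design, `I_x` is already determined by any of its points. -/
theorem pointIntersection_eq_of_mem {P : Set α} {B : Set (Set α)} {v k l : ℕ}
    (h : IsOneDesign P B v k l) (hB : B.Finite) {x y : α} (hx : x ∈ P) (hy : y ∈ P)
    (hxy : y ∈ pointIntersection B x) : pointIntersection B y = pointIntersection B x := by
  have hsub : {b ∈ B | x ∈ b} ⊆ {b ∈ B | y ∈ b} := fun b hb => ⟨hb.1, hxy b hb⟩
  have : {b ∈ B | x ∈ b} = {b ∈ B | y ∈ b} := by
    refine Set.eq_of_subset_of_ncard_le hsub ?_ (hB.subset fun b hb => hb.1)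
    rw [h.card_blocks_through x hx, h.card_blocks_through y hy]
  rw [pointIntersection, pointIntersection, this]

/-- If the sets `I_x` have the same size, they partition each block into parts of that size. -/
theorem ncard_pointIntersection_dvd {P : Set α} {B : Set (Set α)} {v k l n : ℕ}
    (h : IsOneDesign P B v k l) (hB : B.Finite)
    (hn : ∀ x ∈ P, (pointIntersection B x).ncard = n) {b : Set α} (hb : b ∈ B) : n ∣ k := by
  have hP := h.block_subset b hb
  rw [← h.card_block b hb, ncard_eq_mul_ncard_image (pointIntersection B) (s := b) (n := n)
    (h.finite_points.subset hP)]
  · exact dvd_mul_right _ _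
  · intro x hx
    rw [← hn x (hP hx)]
    congr 1
    ext y
    constructor
    · rintro ⟨_, hy⟩
      exact hy ▸ mem_pointIntersection_self B y
    · intro hy
      have hyb := pointIntersection_subset hb hx hy
      exact ⟨hyb, pointIntersection_eq_of_mem h hB (hP hx) (hP hyb) hy⟩

/-- If the sets `I_x` are the orbits of a fixed-point-free involution, the reduced structure is a
`1`-design with half as many points. -/
theorem isOneDesign_reduced {P : Set α} {B : Set (Set α)} {v k l : ℕ}
    (h : IsOneDesign P B v k l) {ι : α → α} (hι : Function.Involutive ι)
    (hιP : ∀ x ∈ P, ι x ∈ P) (hne : ∀ x ∈ P, x ≠ ι x)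
    (hI : ∀ x ∈ P, pointIntersection B x = {x, ι x}) :
    IsOneDesign (reducedPoints P B) (reducedBlocks P B) (v / 2) (k / 2) l := by
  have hpair : ∀ x y, ({y, ι y} : Set α) = {x, ι x} ↔ y = x ∨ y = ι x := by
    intro x y
    constructor
    · intro e
      have : y ∈ ({x, ι x} : Set α) := e ▸ Set.mem_insert _ _
      simpa using this
    · rintro (rfl | rfl)
      · rfl
      · rw [hι x, Set.pair_comm]
  have half : ∀ s ⊆ P, (∀ x ∈ s, ι x ∈ s) →
      ((fun x => ({x, ι x} : Set α)) '' s).ncard = s.ncard / 2 := by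
    intro s hs hιs
    rw [ncard_eq_mul_ncard_image (fun x => ({x, ι x} : Set α)) (n := 2)
      (h.finite_points.subset hs), Nat.mul_div_cancel_left _ two_pos]
    intro x hx
    rw [← Set.ncard_pair (hne x (hs hx))]
    congr 1
    ext y
    simp only [hpair, Set.mem_ofPred_eq, Set.mem_insert_iff, Set.mem_singleton_iff]
    constructor
    · exact fun h => h.2
    · rintro (rfl | rfl)
      · exact ⟨hx, Or.inl rfl⟩
      · exact ⟨hιs x hx, Or.inr rfl⟩
  have hpts : reducedPoints P B = (fun x => ({x, ι x} : Set α)) '' P :=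
    Set.image_congr hI
  -- A block containing `x` contains `I_x`, so each block is a union of `ι`-orbits.
  have hblk : ∀ b ∈ B, ∀ x ∈ b, ι x ∈ b := by
    intro b hb x hx
    have := pointIntersection_subset hb hx
    rw [hI x (h.block_subset b hb hx)] at this
    exact this (by simp)
  have hbar : ∀ b ∈ B, {I ∈ reducedPoints P B | I ⊆ b} =
      (fun x => ({x, ι x} : Set α)) '' b := by
    intro b hb
    rw [hpts]
    ext I
    constructor
    · rintro ⟨⟨x, _, rfl⟩, hx⟩
      exact ⟨x, hx (by simp), rfl⟩
    · rintro ⟨x, hx, rfl⟩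
      refine ⟨⟨x, h.block_subset b hb hx, rfl⟩, ?_⟩
      rintro y (rfl | rfl)
      · exact hx
      · exact hblk b hb x hx
  refine ⟨h.finite_points.image _, ?_, ?_, ?_, ?_⟩
  · rw [hpts, half P subset_rfl hιP, h.card_points]
  · rintro _ ⟨b, _, rfl⟩
    exact fun I hI => hI.1
  · rintro _ ⟨b, hb, rfl⟩
    simp only
    rw [hbar b hb, half b (h.block_subset b hb) (hblk b hb), h.card_block b hb]
  · intro I hIP
    rw [hpts] at hIP
    obtain ⟨x, hx, rfl⟩ := hIP
    simp only
    rw [← h.card_blocks_through x hx,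
      ← Set.InjOn.ncard_image (f := fun b => {I ∈ reducedPoints P B | I ⊆ b})]
    · congr 1
      ext c
      constructor
      · rintro ⟨⟨b, hb, rfl⟩, hc⟩
        exact ⟨b, ⟨hb, hc.2 (by simp)⟩, rfl⟩
      · rintro ⟨b, ⟨hb, hxb⟩, rfl⟩
        refine ⟨⟨b, hb, rfl⟩, ?_⟩
        simp only
        rw [hbar b hb]
        exact ⟨x, hxb, rfl⟩
    -- A block is the union of the pairs it contains, so distinct blocks stay distinct after
    -- reduction and `l` is unchanged.
    · have sub : ∀ b ∈ B, ∀ c ∈ B, {I ∈ reducedPoints P B | I ⊆ b} =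
          {I ∈ reducedPoints P B | I ⊆ c} → b ⊆ c := by
        intro b hb c hc e y hy
        have : ({y, ι y} : Set α) ∈ {I ∈ reducedPoints P B | I ⊆ b} := by
          rw [hbar b hb]
          exact ⟨y, hy, rfl⟩
        rw [e] at this
        exact this.2 (by simp)
      exact fun b hb c hc e =>
        (sub b hb.1 c hc.1 e).antisymm (sub c hc.1 b hb.1 e.symm)

end Design

/-! ### Designs from conjugates of a maximal subgroup -/

section ConjBlocks

variable {G : Type*} [Group G]

theorem mem_conjugatesOf_conj_iff {g u : G} (y : G) :
    y * u * y⁻¹ ∈ conjugatesOf g ↔ u ∈ conjugatesOf g := by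
  have : IsConj u (y * u * y⁻¹) := isConj_iff.2 ⟨y, rfl⟩
  exact ⟨fun h => IsConj.trans h this.symm, fun h => IsConj.trans h this⟩

theorem image_conj_inter (M : Subgroup G) (g y : G) :
    (fun u : G => y⁻¹ * u * y) '' ((M : Set G) ∩ conjugatesOf g) =
      {u | y * u * y⁻¹ ∈ M ∧ u ∈ conjugatesOf g} := by
  ext u
  constructor
  · rintro ⟨w, ⟨hw, hwg⟩, rfl⟩
    have e : y * (y⁻¹ * w * y) * y⁻¹ = w := by group
    refine ⟨by rw [e]; exact hw, ?_⟩
    rw [← mem_conjugatesOf_conj_iff y, e]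
    exact hwg
  · rintro ⟨h1, h2⟩
    exact ⟨y * u * y⁻¹, ⟨h1, (mem_conjugatesOf_conj_iff y).2 h2⟩, by simp [mul_assoc]⟩

theorem mem_conjBlocks_iff {M : Subgroup G} {g : G} {b : Set G} :
    b ∈ conjBlocks M g ↔ ∃ y, b = {u | y * u * y⁻¹ ∈ M ∧ u ∈ conjugatesOf g} := by
  simp only [conjBlocks, image_conj_inter, Set.mem_range, eq_comm]

theorem image_conj_mem_conjBlocks_iff {M : Subgroup G} {g : G} (z : G) (b : Set G) :
    (MulAut.conj z).toEquiv '' b ∈ conjBlocks M g ↔ b ∈ conjBlocks M g := by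
  have key : ∀ (z : G) (b : Set G), b ∈ conjBlocks M g →
      (MulAut.conj z).toEquiv '' b ∈ conjBlocks M g := by
    intro z b hb
    obtain ⟨y, rfl⟩ := mem_conjBlocks_iff.1 hb
    refine mem_conjBlocks_iff.2 ⟨y * z⁻¹, ?_⟩
    ext u
    rw [Equiv.image_eq_preimage_symm]
    simp only [Set.mem_preimage, Set.mem_ofPred_eq]
    have e1 : (MulAut.conj z).toEquiv.symm u = z⁻¹ * u * z⁻¹⁻¹ := by
      rw [inv_inv]; exact MulAut.conj_symm_apply z u
    rw [e1, mem_conjugatesOf_conj_iff]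
    simp [mul_assoc]
  refine ⟨fun h => ?_, key z b⟩
  convert key z⁻¹ _ h
  rw [Set.image_image]
  simp [mul_assoc]

variable [Finite G]

/-- The blocks are in bijection with the conjugates of a maximal subgroup that does not contain
the whole conjugacy class. -/
theorem ncard_conjBlocks {M : Subgroup G} (hmax : IsCoatom M) {g : G} (hg : g ∈ M)
    (hne : ¬ conjugatesOf g ⊆ M) : (conjBlocks M g).ncard = M.index := by
  have hN : ∀ z : G, (∀ u ∈ conjugatesOf g, u ∈ M → z * u * z⁻¹ ∈ M) → z ∈ M := by
    set N := Subgroup.normalizer ((M : Set G) ∩ conjugatesOf g)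
    have hMN : M ≤ N := by
      intro m hm
      rw [Subgroup.mem_set_normalizer_iff]
      intro u
      simp only [Set.mem_inter_iff, mem_conjugatesOf_conj_iff, SetLike.mem_coe]
      rw [M.mul_mem_cancel_right (M.inv_mem hm), M.mul_mem_cancel_left hm]
    -- The stabilizer of `M ∩ g^G` contains `M`; were it all of `G`, the whole class would lie in
    -- `M`.
    have hNM : N = M := by
      rcases hmax.le_iff.1 hMN with h | h
      · exfalso
        apply hne
        intro u hu
        obtain ⟨c, rfl⟩ := isConj_iff.1 hu
        have hc : c ∈ N := h ▸ Subgroup.mem_top c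
        exact (((Subgroup.mem_set_normalizer_iff.1 hc) g).1 ⟨hg, mem_conjugatesOf_self⟩).1
      · exact h
    intro z hz
    rw [← hNM, Subgroup.mem_set_normalizer_iff]
    have hsub : (fun u => z * u * z⁻¹) '' ((M : Set G) ∩ conjugatesOf g) ⊆
        (M : Set G) ∩ conjugatesOf g := by
      rintro _ ⟨u, hu, rfl⟩
      exact ⟨hz u hu.2 hu.1, (mem_conjugatesOf_conj_iff z).2 hu.2⟩
    have hinj : Function.Injective fun u : G => z * u * z⁻¹ := fun a b h => by simpa using h
    have heq := Set.eq_of_subset_of_ncard_le hsub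
      (Set.ncard_image_of_injective _ hinj).ge (Set.toFinite _)
    intro u
    conv_rhs => rw [← heq]
    exact (hinj.mem_set_image (s := (M : Set G) ∩ conjugatesOf g)).symm
  -- Blocks are indexed by `y⁻¹`, so that the block depends only on the left coset in `G ⧸ M`.
  have hrange : conjBlocks M g = Set.range fun y : G ⧸ M => Quotient.liftOn' y
      (fun y : G => {u | y⁻¹ * u * y ∈ M ∧ u ∈ conjugatesOf g}) (by
        intro a b hab
        rw [QuotientGroup.leftRel_apply] at hab
        ext u
        have e : b⁻¹ * u * b = (a⁻¹ * b)⁻¹ * (a⁻¹ * u * a) * (a⁻¹ * b) := by group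
        simp only [Set.mem_ofPred_eq]
        rw [e, M.mul_mem_cancel_right hab, M.mul_mem_cancel_left (M.inv_mem hab)]) := by
    ext b
    rw [mem_conjBlocks_iff]
    constructor
    · rintro ⟨y, rfl⟩
      exact ⟨QuotientGroup.mk y⁻¹, by simp⟩
    · rintro ⟨y, rfl⟩
      induction y using QuotientGroup.induction_on with
      | H y => exact ⟨y⁻¹, by simp⟩
  rw [hrange, ← Nat.card_coe_set_eq, Nat.card_range_of_injective]
  · rfl
  · intro a b
    induction a using QuotientGroup.induction_on with | H a => ?_
    induction b using QuotientGroup.induction_on with | H b => ?_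
    intro hab
    rw [QuotientGroup.eq]
    apply hN
    intro u hu huM
    have hab' : {u | a⁻¹ * u * a ∈ M ∧ u ∈ conjugatesOf g} =
      {u | b⁻¹ * u * b ∈ M ∧ u ∈ conjugatesOf g} := hab
    have : b * u * b⁻¹ ∈ {u | b⁻¹ * u * b ∈ M ∧ u ∈ conjugatesOf g} := by
      refine ⟨by simpa [mul_assoc] using huM, (mem_conjugatesOf_conj_iff b).2 hu⟩
    rw [← hab'] at this
    convert this.1 using 1
    group

/-- Conjugation is transitive on points and permutes blocks, so the replication number is constant;
double counting against `M.index` blocks determines it. The bound `k < v` keeps the class from lying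
inside `M`. -/
theorem isOneDesign_conjBlocks {M : Subgroup G} (hmax : IsCoatom M) {g : G} (hg : g ∈ M)
    {v k l : ℕ} (hv : (conjugatesOf g).ncard = v)
    (hk : ((M : Set G) ∩ conjugatesOf g).ncard = k) (hkv : k < v)
    (hl : M.index * k = v * l) : IsOneDesign (conjugatesOf g) (conjBlocks M g) v k l := by
  have hblk : ∀ b ∈ conjBlocks M g, b ⊆ conjugatesOf g ∧ b.ncard = k := by
    intro b hb
    constructor
    · obtain ⟨y, rfl⟩ := mem_conjBlocks_iff.1 hb
      exact fun u hu => hu.2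
    · obtain ⟨y, rfl⟩ := hb
      rw [← hk]
      exact Set.ncard_image_of_injective _ fun a b h => by simpa using h
  have hne : ¬ conjugatesOf g ⊆ M := by
    intro h
    rw [Set.inter_eq_right.2 h, hv] at hk
    exact hkv.ne' hk
  have hconst : ∀ x ∈ conjugatesOf g, {b ∈ conjBlocks M g | x ∈ b}.ncard =
      {b ∈ conjBlocks M g | g ∈ b}.ncard := by
    intro x hx
    obtain ⟨c, rfl⟩ := isConj_iff.1 hx
    exact ncard_blocksThrough_apply (MulAut.conj c).toEquiv (image_conj_mem_conjBlocks_iff c) g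
  have hcount := card_points_mul_eq_card_blocks_mul (Set.toFinite (conjugatesOf g))
    (Set.toFinite (conjBlocks M g)) (fun b hb => (hblk b hb).1) (fun b hb => (hblk b hb).2) hconst
  rw [ncard_conjBlocks hmax hg hne, hl, hv] at hcount
  have hl' := Nat.eq_of_mul_eq_mul_left (Nat.zero_lt_of_lt hkv) hcount
  exact ⟨Set.toFinite _, hv, fun b hb => (hblk b hb).1, fun b hb => (hblk b hb).2,
    fun x hx => (hconst x hx).trans hl'⟩

/-- A set on which a subgroup acts freely by conjugation has size divisible by the order of the
subgroup. -/
theorem card_dvd_ncard_of_free (T : Subgroup G) {s : Set G}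
    (hs : ∀ t ∈ T, ∀ x ∈ s, t * x * t⁻¹ ∈ s)
    (hfree : ∀ t ∈ T, ∀ x ∈ s, t * x * t⁻¹ = x → t = 1) : Nat.card T ∣ s.ncard := by
  rw [ncard_eq_mul_ncard_image (fun x => Set.range fun t : T => (t : G) * x * (t : G)⁻¹)
    (s := s) (n := Nat.card T) (Set.toFinite s)]
  · exact dvd_mul_right _ _
  intro x hx
  have hinj : Function.Injective fun t : T => (t : G) * x * (t : G)⁻¹ := by
    intro a b hab
    have h : ((b⁻¹ * a : T) : G) * x * ((b⁻¹ * a : T) : G)⁻¹ = x := by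
      simp only at hab
      calc ((b⁻¹ * a : T) : G) * x * ((b⁻¹ * a : T) : G)⁻¹
          = (b : G)⁻¹ * ((a : G) * x * (a : G)⁻¹) * b := by push_cast; group
        _ = x := by rw [hab]; group
    have := hfree _ (b⁻¹ * a).2 x hx h
    exact (inv_mul_eq_one.1 (Subtype.ext this : b⁻¹ * a = 1)).symm
  rw [← Nat.card_range_of_injective hinj, Nat.card_coe_set_eq]
  congr 1
  ext y
  constructor
  · rintro ⟨_, hy⟩
    rw [← hy]
    exact ⟨1, by simp⟩
  · rintro ⟨t, rfl⟩
    refine ⟨hs t t.2 x hx, ?_⟩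
    ext z
    constructor
    · rintro ⟨r, rfl⟩
      exact ⟨r * t, by simp [mul_assoc]⟩
    · rintro ⟨r, rfl⟩
      exact ⟨r * t⁻¹, by simp [mul_assoc]⟩

/-- If centralizers of elements of the class of `g` meet trivially unless the elements are equal
or inverse, and the sizes leave no room for larger sets, then `I_x = {x, x⁻¹}`. -/
theorem pointIntersection_conjBlocks {M : Subgroup G} {g : G} (hg : g ∈ M) {v k l : ℕ}
    (hD : IsOneDesign (conjugatesOf g) (conjBlocks M g) v k l)
    (hinv : g⁻¹ ∈ conjugatesOf g) (hne : g ≠ g⁻¹)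
    (hfree : ∀ y ∈ conjugatesOf g, y ≠ g → y ≠ g⁻¹ → ∀ t, Commute t g → Commute t y → t = 1)
    (hdvd : ∀ m, 2 + Nat.card (Subgroup.centralizer {g}) * m ∣ k → m = 0) :
    ∀ x ∈ conjugatesOf g, pointIntersection (conjBlocks M g) x = {x, x⁻¹} := by
  set I := pointIntersection (conjBlocks M g) with hI
  have hM : {u | u ∈ M ∧ u ∈ conjugatesOf g} ∈ conjBlocks M g :=
    mem_conjBlocks_iff.2 ⟨1, by simp⟩
  have hIP : I g ⊆ conjugatesOf g :=
    (pointIntersection_subset hM ⟨hg, mem_conjugatesOf_self⟩).trans fun u hu => hu.2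
  have hconj : ∀ c x, I (c * x * c⁻¹) = (MulAut.conj c).toEquiv '' I x := fun c x =>
    pointIntersection_apply (MulAut.conj c).toEquiv (image_conj_mem_conjBlocks_iff c) x
  -- Each block is a conjugate of `M`, a subgroup, intersected with an inverse-closed class.
  have hpair : {g, g⁻¹} ⊆ I g := by
    rintro u (rfl | rfl)
    · exact mem_pointIntersection_self _ _
    · rintro b ⟨hb, hgb⟩
      obtain ⟨y, rfl⟩ := mem_conjBlocks_iff.1 hb
      refine ⟨?_, hinv⟩
      have := M.inv_mem hgb.1
      simpa [mul_assoc] using this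
  have hcard : ∀ x ∈ conjugatesOf g, (I x).ncard = (I g).ncard := by
    intro x hx
    obtain ⟨c, rfl⟩ := isConj_iff.1 hx
    rw [hconj, Set.ncard_image_of_injective _ (Equiv.injective _)]
  -- The centralizer of `g` preserves `I_g` and fixes `g` and `g⁻¹`; by `hfree` it acts freely on
  -- the remaining points.
  have hdiff : Nat.card (Subgroup.centralizer {g}) ∣ (I g \ {g, g⁻¹}).ncard := by
    have hcent : ∀ t ∈ Subgroup.centralizer {g}, t * g * t⁻¹ = g := by
      intro t ht
      rw [Subgroup.mem_centralizer_singleton_iff.1 ht, mul_inv_cancel_right]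
    apply card_dvd_ncard_of_free
    · rintro t ht x ⟨hx, hx'⟩
      have htg := hcent t ht
      refine ⟨?_, fun h => hx' ?_⟩
      · have := hconj t g
        rw [htg] at this
        rw [this]
        exact ⟨x, hx, rfl⟩
      · have e : x = t⁻¹ * (t * x * t⁻¹) * t := by group
        have e2 : t⁻¹ * g * t = g := by
          conv_lhs => rw [← htg]
          group
        rcases h with h | h
        · left
          rw [e, h, e2]
        · right
          have h : t * x * t⁻¹ = g⁻¹ := h
          change x = g⁻¹
          have e3 : t⁻¹ * g⁻¹ * t = (t⁻¹ * g * t)⁻¹ := by group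
          rw [e, h, e3, e2]
    · rintro t ht x ⟨hx, hx'⟩ htx
      refine hfree x (hIP hx) (fun h => hx' (by simp [h])) (fun h => hx' (by simp [h])) t ?_ ?_
      · exact mul_inv_eq_iff_eq_mul.1 (hcent t ht)
      · exact mul_inv_eq_iff_eq_mul.1 htx
  obtain ⟨m, hm⟩ := hdiff
  have htot : (I g).ncard = 2 + Nat.card (Subgroup.centralizer {g}) * m := by
    rw [← hm, ← Set.ncard_pair hne, add_comm, Set.ncard_sdiff_add_ncard_of_subset hpair]
  have hm0 : m = 0 := by
    apply hdvd
    rw [← htot]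
    exact ncard_pointIntersection_dvd hD (Set.toFinite _) hcard hM
  have hIg : I g = {g, g⁻¹} := by
    refine (Set.eq_of_subset_of_ncard_le hpair ?_ (Set.toFinite _)).symm
    rw [htot, hm0, Set.ncard_pair hne]
    simp
  intro x hx
  obtain ⟨c, rfl⟩ := isConj_iff.1 hx
  rw [hconj, hIg, Set.image_pair]
  simp [mul_assoc]

end ConjBlocks

theorem card_centralizer_mul_ncard_conjugatesOf {G : Type*} [Group G] (g : G) :
    Nat.card (Subgroup.centralizer {g}) * (conjugatesOf g).ncard = Nat.card G := by
  have h := (MulAction.stabilizer (ConjAct G) g).card_mul_index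
  rw [MulAction.index_stabilizer, ← Subgroup.nat_card_centralizer_nat_card_stabilizer] at h
  have e : MulAction.orbit (ConjAct G) g = conjugatesOf g := by
    ext u
    rw [ConjAct.mem_orbit_conjAct, isConj_comm]
    rfl
  rw [e] at h
  exact h

theorem orderOf_eq_of_isConj {G : Type*} [Group G] {g h : G} (H : IsConj g h) :
    orderOf h = orderOf g := by
  obtain ⟨c, rfl⟩ := isConj_iff.1 H
  exact MulEquiv.orderOf_eq (MulAut.conj c) g

/-- The size `q * s` of the blocks, `s = q ± 1`, leaves no room for sets `I_x` with more than two
elements. -/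
theorem eq_zero_of_two_add_mul_dvd {q s c m : ℕ} (hq : 3 < q) (hs : s = q + 1 ∨ s = q - 1)
    (hc : 2 * c + 1 = q ^ 2) (h : 2 + c * m ∣ q * s) : m = 0 := by
  obtain ⟨j, hj⟩ := h
  by_contra hm
  have hs1 : s ≠ 0 := by omega
  have hj0 : j ≠ 0 := by
    rintro rfl
    rw [mul_zero] at hj
    exact (mul_ne_zero (by omega) hs1) hj
  -- Here `c = (q² - 1)/2`, so `j * m ≥ 3` would give a product of at least `2 + 3(q² - 1)/2`, which
  -- exceeds `q(q + 1)`.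
  have hjm : j * m < 3 := by
    by_contra hlt
    have h3 : c * 3 ≤ c * (j * m) := Nat.mul_le_mul_left c (not_lt.1 hlt)
    have h4 : q * s ≤ q * (q + 1) := Nat.mul_le_mul_left q (by omega)
    have h5 : (2 + c * m) * j = 2 * j + c * (j * m) := by ring
    nlinarith [Nat.one_le_iff_ne_zero.2 hj0]
  have hj2 : j < 3 := lt_of_le_of_lt (Nat.le_mul_of_pos_right j (Nat.pos_of_ne_zero hm)) hjm
  have hm2 : m < 3 := lt_of_le_of_lt (Nat.le_mul_of_pos_left m (Nat.pos_of_ne_zero hj0)) hjm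
  -- The bound `q > 3` is sharp: at `q = 3`, `j = m = 1` solves the minus case and `j = 2, m = 1`
  -- the plus case.
  obtain ⟨n, rfl⟩ : ∃ n, q = n + 4 := ⟨q - 4, by omega⟩
  rcases hs with rfl | rfl
  · interval_cases j <;> interval_cases m <;> first | omega | nlinarith
  · have e : n + 4 - 1 = n + 3 := by omega
    rw [e] at hj
    interval_cases j <;> interval_cases m <;> first | omega | nlinarith

/-! ### Parameters for PGL(2, q) inside PSL(2, q²) -/

section Counts

variable {G : Type*} [Group G] [Finite G]

/-- The designs on a conjugacy class, with the parameters of `PGL(2, q) < PSL(2, q ^ 2)`. -/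
theorem isOneDesign_of_card {M : Subgroup G} (hmax : IsCoatom M) {g : G} (hgM : g ∈ M) {q s : ℕ}
    (hq : Odd q) (hs : s = q + 1 ∨ s = q - 1) (hq1 : 1 < q)
    (hG : Nat.card G * 2 = q ^ 2 * (q ^ 2 - 1) * (q ^ 2 + 1))
    (hM : Nat.card M = q * (q ^ 2 - 1))
    (hv : (conjugatesOf g).ncard = q ^ 2 * (q ^ 2 + 1))
    (hk : ((M : Set G) ∩ conjugatesOf g).ncard = q * s)
    (hinv : g⁻¹ ∈ conjugatesOf g) (hne : g ≠ g⁻¹)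
    (hfree : ∀ y ∈ conjugatesOf g, y ≠ g → y ≠ g⁻¹ →
      ∀ t, Commute t g → Commute t y → t = 1) :
    IsOneDesign (conjugatesOf g) (conjBlocks M g) (q ^ 2 * (q ^ 2 + 1)) (q * s) (s / 2) ∧
    (3 < q →
      (∀ x ∈ conjugatesOf g, pointIntersection (conjBlocks M g) x = {x, x⁻¹}) ∧
      IsOneDesign (reducedPoints (conjugatesOf g) (conjBlocks M g))
        (reducedBlocks (conjugatesOf g) (conjBlocks M g))
        (q ^ 2 * (q ^ 2 + 1) / 2) (q * s / 2) (s / 2)) := by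
  have hqq : 1 < q ^ 2 := Nat.one_lt_pow two_ne_zero hq1
  have hq0 : 0 < q := by omega
  obtain ⟨a, ha⟩ : ∃ a, q ^ 2 = a + 1 := ⟨q ^ 2 - 1, by omega⟩
  have ha0 : 0 < a := by omega
  have hidx : 2 * M.index = q * (q ^ 2 + 1) := by
    have h := M.card_mul_index
    have hpos : 0 < q * (q ^ 2 - 1) := Nat.mul_pos hq0 (by omega)
    apply Nat.eq_of_mul_eq_mul_left hpos
    rw [hM] at h
    calc q * (q ^ 2 - 1) * (2 * M.index) = q * (q ^ 2 - 1) * M.index * 2 := by ring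
      _ = q ^ 2 * (q ^ 2 - 1) * (q ^ 2 + 1) := by rw [h, hG]
      _ = _ := by ring
  have hs2 : 2 * (s / 2) = s := by
    obtain ⟨r, hr⟩ := hq
    omega
  have hD := isOneDesign_conjBlocks hmax hgM hv hk (l := s / 2) (by
      have : s ≤ q + 1 := by omega
      calc q * s ≤ q * (q + 1) := Nat.mul_le_mul_left _ this
        _ < q ^ 2 * (q ^ 2 + 1) := by nlinarith) (by
      apply Nat.eq_of_mul_eq_mul_left two_pos
      calc 2 * (M.index * (q * s)) = 2 * M.index * (q * s) := by ring
        _ = q ^ 2 * (q ^ 2 + 1) * s := by rw [hidx]; ring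
        _ = q ^ 2 * (q ^ 2 + 1) * (2 * (s / 2)) := by rw [hs2]
        _ = _ := by ring)
  refine ⟨hD, fun hq3 => ?_⟩
  -- Dividing the group order by the class size shows that the centralizer has order `(q² - 1)/2`.
  have hcent : 2 * Nat.card (Subgroup.centralizer {g}) + 1 = q ^ 2 := by
    have h := card_centralizer_mul_ncard_conjugatesOf g
    rw [hv] at h
    rw [← h, ha, Nat.add_sub_cancel] at hG
    have hpos : 0 < (a + 1) * (a + 1 + 1) := by positivity
    have : 2 * Nat.card (Subgroup.centralizer {g}) = a := by
      apply Nat.eq_of_mul_eq_mul_left hpos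
      linarith
    omega
  have hI := pointIntersection_conjBlocks hgM hD hinv hne hfree
    fun m hm => eq_zero_of_two_add_mul_dvd hq3 hs hcent hm
  have hinvP : ∀ x ∈ conjugatesOf g, x⁻¹ ∈ conjugatesOf g := by
    intro x hx
    obtain ⟨c, rfl⟩ := isConj_iff.1 hx
    have : (c * g * c⁻¹)⁻¹ = c * g⁻¹ * c⁻¹ := by group
    rw [this, mem_conjugatesOf_conj_iff]
    exact hinv
  have hneP : ∀ x ∈ conjugatesOf g, x ≠ x⁻¹ := by
    intro x hx
    obtain ⟨c, rfl⟩ := isConj_iff.1 hx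
    intro h
    apply hne
    have : (c * g * c⁻¹)⁻¹ = c * g⁻¹ * c⁻¹ := by group
    rw [this] at h
    simpa using h
  exact ⟨hI, isOneDesign_reduced hD inv_involutive hinvP hneP hI⟩

end Counts

/-! ### Fusion of classes and the main theorem -/

theorem two_ne_zero_of_odd_card {E : Type*} [Field E] [Fintype E] (h : Odd (Fintype.card E)) :
    (2 : E) ≠ 0 := by
  intro h2
  obtain ⟨m, hm⟩ := h
  have h0 := FiniteField.cast_card_eq_zero E
  rw [hm] at h0
  push_cast at h0
  rw [h2, zero_mul, zero_add] at h0
  exact one_ne_zero h0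

theorem charP_of_card_eq_sq {F K : Type*} [Field F] [Fintype F] [Field K] [Fintype K] (p : ℕ)
    [Fact p.Prime] [CharP F p] (h : Fintype.card K = Fintype.card F ^ 2) : CharP K p := by
  obtain ⟨n, -, hn⟩ := FiniteField.card F p
  have h0 := FiniteField.cast_card_eq_zero K
  rw [h, hn] at h0
  push_cast at h0
  have h1 : (p : K) = 0 :=
    (pow_eq_zero_iff n.ne_zero).1 ((pow_eq_zero_iff two_ne_zero).1 h0)
  obtain ⟨r, hr⟩ := CharP.exists K
  have hrp : r.Prime := CharP.char_is_prime K r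
  have : r = p := (Nat.prime_dvd_prime_iff_eq hrp Fact.out).1 ((CharP.cast_eq_zero_iff K r p).1 h1)
  exact this ▸ hr

/-- If `M` is isomorphic to `PGL(2, F)`, the elements of `M` in the class of `g` form one
`M`-class. -/
theorem inter_conjugatesOf_eq_image {F : Type*} [Field F] (h2 : (2 : F) ≠ 0)
    (p : ℕ) [Fact p.Prime] [CharP F p] {G : Type*} [Group G] {M : Subgroup G}
    (e : M ≃* Matrix.ProjGenLinGroup (Fin 2) F) {g : G} (hgM : g ∈ M)
    (hord : 2 < orderOf g) (hp : g ^ p ≠ 1)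
    (hfree : ∀ y ∈ conjugatesOf g, y ≠ g → y ≠ g⁻¹ → ∀ t, Commute t g → Commute t y → t = 1) :
    (M : Set G) ∩ conjugatesOf g = (fun n => (e.symm n : G)) '' conjugatesOf (e ⟨g, hgM⟩) := by
  have hordm : ∀ h (hh : h ∈ M), orderOf (e ⟨h, hh⟩) = orderOf h := fun h hh => by
    rw [MulEquiv.orderOf_eq, Subgroup.orderOf_mk]
  have hmp : e ⟨g, hgM⟩ ^ p ≠ 1 := by
    rw [Ne, ← orderOf_dvd_iff_pow_eq_one, hordm, orderOf_dvd_iff_pow_eq_one]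
    exact hp
  have hconj : ∀ n, IsConj (e ⟨g, hgM⟩) n → IsConj g (e.symm n : G) := by
    intro n hn
    have := MonoidHom.map_isConj (M.subtype.comp e.symm.toMonoidHom) hn
    simpa using this
  ext h
  constructor
  · rintro ⟨hM, hg⟩
    refine ⟨e ⟨h, hM⟩, ?_, by simp⟩
    obtain ⟨⟨k, hk⟩, hinv⟩ := Matrix.ProjGenLinGroup.exists_isConj_pow h2 (n := e ⟨h, hM⟩) p
      (by rwa [hordm]) (by rw [hordm, hordm, orderOf_eq_of_isConj hg]) hmp
    have hgk : g ^ k ∈ conjugatesOf g := by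
      have := MonoidHom.map_isConj (M.subtype.comp e.symm.toMonoidHom) hk
      have : IsConj (g ^ k) h := by simpa using this
      exact IsConj.trans hg this.symm
    have h1 : g ≠ 1 := by
      rintro rfl
      simp at hord
    -- `g` itself is a nontrivial element commuting with both `g` and `g ^ k`, so `hfree` leaves
    -- only these two options.
    have hcases : g ^ k = g ∨ g ^ k = g⁻¹ := by
      by_contra hc
      rw [not_or] at hc
      exact h1 (hfree _ hgk hc.1 hc.2 g (Commute.refl g) (Commute.self_pow g k))
    rcases hcases with hc | hc
    · have : e ⟨g, hgM⟩ ^ k = e ⟨g, hgM⟩ := by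
        rw [← map_pow]
        exact congrArg e (Subtype.ext hc)
      rwa [this] at hk
    · have : e ⟨g, hgM⟩ ^ k = (e ⟨g, hgM⟩)⁻¹ := by
        rw [← map_pow, ← map_inv]
        exact congrArg e (Subtype.ext hc)
      rw [this] at hk
      exact hinv.trans hk
  · rintro ⟨n, hn, rfl⟩
    exact ⟨(e.symm n).2, hconj n hn⟩

theorem mainTheorem10 {F K : Type*} [Field F] [Fintype F] [Field K] [Fintype K]
    (q : ℕ) (hq : Odd q) (hF : Fintype.card F = q) (hK : Fintype.card K = q ^ 2)
    (M : Subgroup (Matrix.ProjectiveSpecialLinearGroup (Fin 2) K))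
    (hmax : IsCoatom M)
    (hM : Nonempty (M ≃* Matrix.ProjGenLinGroup (Fin 2) F))
    (g : Matrix.ProjectiveSpecialLinearGroup (Fin 2) K)
    (hgM : g ∈ M) (hss : IsSemisimplePSL g) (hord : 2 < orderOf g) :
    (orderOf g ∣ q - 1 ∨ orderOf g ∣ q + 1) ∧
    (orderOf g ∣ q - 1 →
      IsOneDesign (conjugatesOf g) (conjBlocks M g)
        (q ^ 2 * (q ^ 2 + 1)) (q * (q + 1)) ((q + 1) / 2) ∧
      (∀ x ∈ conjugatesOf g, pointIntersection (conjBlocks M g) x = {x, x⁻¹}) ∧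
      IsOneDesign (reducedPoints (conjugatesOf g) (conjBlocks M g))
        (reducedBlocks (conjugatesOf g) (conjBlocks M g))
        (q ^ 2 * (q ^ 2 + 1) / 2) (q * (q + 1) / 2) ((q + 1) / 2)) ∧
    (orderOf g ∣ q + 1 →
      IsOneDesign (conjugatesOf g) (conjBlocks M g)
        (q ^ 2 * (q ^ 2 + 1)) (q * (q - 1)) ((q - 1) / 2) ∧
      (3 < q →
        (∀ x ∈ conjugatesOf g, pointIntersection (conjBlocks M g) x = {x, x⁻¹}) ∧
        IsOneDesign (reducedPoints (conjugatesOf g) (conjBlocks M g))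
          (reducedBlocks (conjugatesOf g) (conjBlocks M g))
          (q ^ 2 * (q ^ 2 + 1) / 2) (q * (q - 1) / 2) ((q - 1) / 2))) := by
  obtain ⟨e⟩ := hM
  obtain ⟨p, hpF, n, hp, -⟩ := FiniteField.card' F
  have : Fact p.Prime := ⟨hp⟩
  have hpK : CharP K p := charP_of_card_eq_sq (F := F) p (by rw [hF, hK])
  have h2F : (2 : F) ≠ 0 := two_ne_zero_of_odd_card (by rwa [hF])
  have h2K : (2 : K) ≠ 0 := two_ne_zero_of_odd_card (by rw [hK]; exact hq.pow)
  have hq1 : 1 < q := hF ▸ Fintype.one_lt_card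
  have hqq : 1 < q ^ 2 := Nat.one_lt_pow two_ne_zero hq1
  have hg1 : g ≠ 1 := by
    rintro rfl
    simp at hord
  have hg2 : g ^ 2 ≠ 1 := fun h =>
    absurd (Nat.le_of_dvd two_pos (orderOf_dvd_of_pow_eq_one h)) hord.not_ge
  have hne : g ≠ g⁻¹ := fun h => hg2 (by
    rw [pow_two]
    exact mul_eq_one_iff_eq_inv.2 h)
  obtain ⟨A, hA, hAss⟩ := hss
  have hgp : g ^ p ≠ 1 := fun h => hg1 (by
    rw [← hA] at h ⊢
    exact Matrix.ProjectiveSpecialLinearGroup.eq_one_of_pow_char_eq_one p hAss h)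
  have hA0 := Matrix.ProjectiveSpecialLinearGroup.trace_ne_zero_of_sq_ne_one (A := A)
    (by rwa [hA])
  have hA4 := Matrix.ProjectiveSpecialLinearGroup.trace_sq_ne_four_of_isSemisimple h2K hAss
    (by rwa [hA])
  have hfree : ∀ y ∈ conjugatesOf g, y ≠ g → y ≠ g⁻¹ →
      ∀ t, Commute t g → Commute t y → t = 1 := by
    intro y hy h1 h2 t htg hty
    by_contra ht
    rw [← hA] at h1 h2 htg
    have hy : IsConj (QuotientGroup.mk A) y := by
      rw [hA]
      exact hy
    rcases Matrix.ProjectiveSpecialLinearGroup.eq_or_eq_inv_of_commute h2K hA0 hA4 hy htg hty ht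
      with h | h
    · exact h1 h
    · exact h2 h
  have hordm : orderOf (e ⟨g, hgM⟩) = orderOf g := by
    rw [MulEquiv.orderOf_eq, Subgroup.orderOf_mk]
  have hmp : e ⟨g, hgM⟩ ^ p ≠ 1 := by
    rw [Ne, ← orderOf_dvd_iff_pow_eq_one, hordm, orderOf_dvd_iff_pow_eq_one]
    exact hgp
  have himage := inter_conjugatesOf_eq_image h2F p e hgM hord hgp hfree
  have hk : ((M : Set (Matrix.ProjectiveSpecialLinearGroup (Fin 2) K)) ∩ conjugatesOf g).ncard =
      (conjugatesOf (e ⟨g, hgM⟩)).ncard := by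
    rw [himage]
    exact Set.ncard_image_of_injective _ (Subtype.val_injective.comp e.symm.injective)
  have hinv : g⁻¹ ∈ conjugatesOf g := by
    have h := (Matrix.ProjGenLinGroup.exists_isConj_pow h2F (n := e ⟨g, hgM⟩) p
      (by rwa [hordm]) rfl hmp).2
    have := MonoidHom.map_isConj (M.subtype.comp e.symm.toMonoidHom) h
    have : IsConj g g⁻¹ := by simpa using this
    exact this
  obtain ⟨hdvd, hplus, hminus⟩ := Matrix.ProjGenLinGroup.orderOf_dvd_and_ncard_conjugatesOf h2F p
    (m := e ⟨g, hgM⟩) (by rwa [hordm]) hmp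
  rw [hordm, hF] at hdvd hplus hminus
  -- The order divides one of `q - 1`, `q + 1` and the other is even, so twice the order divides
  -- their product. This puts the eigenvalues in `K` in both cases, so the class size is the same.
  have h2d : 2 * orderOf g ∣ Fintype.card K - 1 := by
    obtain ⟨r, hr⟩ := hq
    have e1 : q ^ 2 - 1 = (q + 1) * (q - 1) := by
      have := Nat.sq_sub_sq q 1
      rwa [one_pow] at this
    rw [hK, e1]
    rcases hdvd with h | h
    · exact mul_dvd_mul ⟨r + 1, by omega⟩ h
    · rw [mul_comm 2]
      exact mul_dvd_mul h ⟨r, by omega⟩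
  have hv : (conjugatesOf g).ncard = q ^ 2 * (q ^ 2 + 1) := by
    obtain ⟨a, b, hab, hab1, htr⟩ := Matrix.ProjectiveSpecialLinearGroup.exists_eigenvalues h2K hA4
      (d := orderOf g) (by rw [hA, pow_orderOf_eq_one]) h2d
    rw [← hA, Matrix.ProjectiveSpecialLinearGroup.ncard_conjugatesOf_mk hA0 hab hab1 htr, hK]
  have hcardG : Nat.card (Matrix.ProjectiveSpecialLinearGroup (Fin 2) K) * 2 =
      q ^ 2 * (q ^ 2 - 1) * (q ^ 2 + 1) := by
    have h := Matrix.ProjectiveSpecialLinearGroup.card_mul h2K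
    rw [hK] at h
    obtain ⟨a, ha⟩ : ∃ a, q ^ 2 = a + 1 := ⟨q ^ 2 - 1, by omega⟩
    have e1 : (a + 1) ^ 2 - 1 = a * (a + 2) := Nat.sub_eq_of_eq_add (by ring)
    have e2 : (a + 1) ^ 2 - (a + 1) = a * (a + 1) := Nat.sub_eq_of_eq_add (by ring)
    rw [ha, Nat.add_sub_cancel, e1, e2] at h
    rw [ha, Nat.add_sub_cancel]
    apply Nat.eq_of_mul_eq_mul_right (show 0 < a by omega)
    rw [h]
    ring
  have hcardM : Nat.card M = q * (q ^ 2 - 1) := by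
    have h := Matrix.ProjGenLinGroup.card_mul (E := F)
    rw [hF] at h
    rw [Nat.card_congr e.toEquiv]
    have e1 : q ^ 2 - q = q * (q - 1) := by rw [pow_two, Nat.mul_sub_one]
    rw [e1, ← mul_assoc] at h
    rw [Nat.eq_of_mul_eq_mul_right (show 0 < q - 1 by omega) h, mul_comm]
  refine ⟨hdvd, fun h => ?_, fun h => ?_⟩
  -- An order above `2` dividing `q - 1` already forces `q > 3`; only the minus case needs it as an
  -- assumption.
  · have hq3 : 3 < q := by
      have h1 := Nat.le_of_dvd (by omega) h
      omega
    obtain ⟨h1, h3⟩ := isOneDesign_of_card hmax hgM hq (Or.inl rfl) hq1 hcardG hcardM hv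
      (hk.trans (hplus h)) hinv hne hfree
    exact ⟨h1, h3 hq3⟩
  · exact isOneDesign_of_card hmax hgM hq (Or.inr rfl) hq1 hcardG hcardM hv
      (hk.trans (hminus h)) hinv hne hfree
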